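/- Let $L$ be a smooth ($C^\infty$) field of endomorphisms on a neighborhood of $0$ in $\mathbb{R}^3$ which is a Nijenhuis operator, i.e. $L^2[u,v]+[Lu,Lv]-L[Lu,v]-L[u,Lv]=0$ for all smooth vector fields $u,v$. Let $\sigma_1,\sigma_2,\sigma_3$ be the coefficients of its characteristic polynomial $\chi(t)=\det(t\,\mathrm{Id}-L)=t^3+\sigma_1t^2+\sigma_2t+\sigma_3$. Suppose that $d\sigma_1$ and $d\sigma_2$ are linearly independent at every point of a neighborhood of $0$, that $\sigma_1(0)=\sigma_2(0)=0$ and $\sigma_3(0)=c$, and that $\sigma_3$ has a Morse singularity at $0$ on the curve $\{\sigma_1=\sigma_2=0\}$, i.e. the restriction of $\sigma_3$ to this curve has a nondegenerate critical point at $0$. Then there are smooth local coordinates $(x,y,z)$ in a neighborhood of $0$, centered at $0$, and a choice of the sign $\pm$ (the same at all places below) such that in these coordinates $$ L=\begin{bmatrix} -x & 1 & 0\\ -y-c^{2/3} & c^{1/3} & \pm 2z\\ -\frac z2 & 0 & -c^{1/3}\end{bmatrix}, \qquad \chi(t)=t^3+xt^2+yt\pm z^2+c^{1/3}y-c^{2/3}x+c,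 $$ where $c^{1/3}$ is the real cube root of $c\in\mathbb{R}$ and $c^{2/3}=(c^{1/3})^2$. -/

import Mathlib

open Set Filter Topology
open scoped ContDiff

noncomputable section

/-- The Nijenhuis torsion
`N_L(u,v) = L²[u,v] + [Lu,Lv] - L[Lu,v] - L[u,Lv]` of an operator field `L`,
evaluated at the point `p`. -/
def nijenhuisTorsion {E : Type*} [NormedAddCommGroup E] [NormedSpace ℝ E]
    (L : E → E →L[ℝ] E) (u v : E → E) (p : E) : E :=
  L p (L p (VectorField.lieBracket ℝ u v p))
    + VectorField.lieBracket ℝ (fun q => L q (u q)) (fun q => L q (v q)) p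
    - L p (VectorField.lieBracket ℝ (fun q => L q (u q)) v p)
    - L p (VectorField.lieBracket ℝ u (fun q => L q (v q)) p)

/-- `L` is a (smooth) Nijenhuis operator on the open set `U`: a smooth field of endomorphisms
whose Nijenhuis torsion vanishes on all smooth vector fields on `U`. -/
structure IsNijenhuisOn {E : Type*} [NormedAddCommGroup E] [NormedSpace ℝ E]
    (L : E → E →L[ℝ] E) (U : Set E) : Prop where
  smooth : ContDiffOn ℝ ∞ L U
  torsion_eq_zero : ∀ u v : E → E, ContDiffOn ℝ ∞ u U → ContDiffOn ℝ ∞ v U →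
    ∀ p ∈ U, nijenhuisTorsion L u v p = 0

/-- For an operator field `L` on (an open subset of) `ℝ³`, the coefficient `σ_i` in
`det (t Id - L) = t³ + σ₁ t² + σ₂ t + σ₃`, as a function of the point (`i = 1, 2, 3`). -/
def sigma (L : (Fin 3 → ℝ) → (Fin 3 → ℝ) →L[ℝ] (Fin 3 → ℝ)) (i : ℕ) (p : Fin 3 → ℝ) : ℝ :=
  (L p : (Fin 3 → ℝ) →ₗ[ℝ] (Fin 3 → ℝ)).charpoly.coeff (3 - i)

/-- Let `S` be a set that is a regular smooth curve near `p`. The function `f` has a Morse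
singularity at `p` on `S`: in a regular smooth local parametrization `γ` of `S` with `γ 0 = p`,
the function `f ∘ γ` has a nondegenerate critical point at `0`. -/
def HasMorseSingularityOnCurve {E : Type*} [NormedAddCommGroup E] [NormedSpace ℝ E]
    (f : E → ℝ) (S : Set E) (p : E) : Prop :=
  ∃ (γ : ℝ → E) (δ : ℝ), 0 < δ ∧ ContDiffOn ℝ ∞ γ (Ioo (-δ) δ) ∧ MapsTo γ (Ioo (-δ) δ) S ∧
    γ 0 = p ∧ deriv γ 0 ≠ 0 ∧
    deriv (f ∘ γ) 0 = 0 ∧ iteratedDeriv 2 (f ∘ γ) 0 ≠ 0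

/-- The real cube root. -/
def cbrt (c : ℝ) : ℝ := if 0 ≤ c then c ^ (1 / 3 : ℝ) else -((-c) ^ (1 / 3 : ℝ))

theorem cbrt_pow_three (c : ℝ) : cbrt c ^ 3 = c := by
  have key : ∀ d : ℝ, 0 ≤ d → (d ^ (1 / 3 : ℝ)) ^ 3 = d := by
    intro d hd
    rw [← Real.rpow_natCast, ← Real.rpow_mul hd]
    norm_num
  unfold cbrt
  split_ifs with h
  · exact key c h
  · have := key (-c) (by linarith)
    linear_combination -this

/-- The matrix, in the coordinates given by a local diffeomorphism `φ` of `ℝ³`, of the operator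
field `L` at the point `p` of the domain of `φ`: it is `J L J⁻¹` with `J` the Jacobi matrix. -/
def matrixInCoordinates (L : (Fin 3 → ℝ) → (Fin 3 → ℝ) →L[ℝ] (Fin 3 → ℝ))
    (φ : OpenPartialHomeomorph (Fin 3 → ℝ) (Fin 3 → ℝ)) (p : Fin 3 → ℝ) :
    Matrix (Fin 3) (Fin 3) ℝ :=
  LinearMap.toMatrix'
    (((fderiv ℝ φ p).comp ((L p).comp (fderiv ℝ φ.symm (φ p))) :
      (Fin 3 → ℝ) →L[ℝ] (Fin 3 → ℝ)) : (Fin 3 → ℝ) →ₗ[ℝ] (Fin 3 → ℝ))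

/-- The normal form; the sign `±` is `ε`. -/
def normalForm (ε c x y z : ℝ) : Matrix (Fin 3) (Fin 3) ℝ :=
  !![-x, 1, 0;
     -y - cbrt c ^ 2, cbrt c, ε * (2 * z);
     -(z / 2), 0, -cbrt c]

end

/-! For a Nijenhuis operator, contracting the torsion identity with the derivatives of the `σ_i`
with respect to the entries of `L` gives `L* dσ₁ = dσ₂ - σ₁ dσ₁`, `L* dσ₂ = dσ₃ - σ₂ dσ₁`, `L* dσ₃ =
-σ₃ dσ₁`. A Morse lemma with parameters (`exists_morse_chart`) gives coordinates with `x = σ₁`, `y =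
σ₂`, `σ₃ = G(x, y) ± z²`. The first two relations are then the first two rows of the matrix of `L`,
up to the unknown `G`.

On `z = 0` the third relation involves `G` alone. Its `dy` and `dx` coefficients say `G_x = -G_y²`
and `G = G_y³ - x G_y² + y G_y`. Differentiating the second and using the first leaves `(3 G_y² - 2
x G_y + y) dG_y = 0`, which forces `G_y` to be constant near `0` (`eq_affine_of_clairaut`). At the
origin `G_y³ = c`, so `G = c^{1/3} y - c^{2/3} x + c`.

With this `G` the third relation becomes `z` times the formula for the third row. The factor `z` is
cancelled by division where `z ≠ 0` and by differentiation in `z` where `z = 0`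
(`eq_zero_of_mul_eventuallyEq_zero`). -/

/-! ### Parameter integrals and the second order Hadamard lemma. -/

/-- Differentiation under the integral sign, over a compact interval. -/
theorem hasFDerivAt_intervalIntegral_of_contDiff {E F : Type*} [NormedAddCommGroup E]
    [NormedSpace ℝ E] [FiniteDimensional ℝ E] [NormedAddCommGroup F] [NormedSpace ℝ F]
    {k : E × ℝ → F} (hk : ContDiff ℝ 1 k) (a b : ℝ) (x₀ : E) :
    HasFDerivAt (fun x => ∫ t in a..b, k (x, t))
      (∫ t in a..b, (fderiv ℝ k (x₀, t)).comp (ContinuousLinearMap.inl ℝ E ℝ)) x₀ := by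
  have hcont : Continuous fun p : E × ℝ =>
      (fderiv ℝ k p).comp (ContinuousLinearMap.inl ℝ E ℝ) :=
    (hk.continuous_fderiv (by norm_num)).clm_comp continuous_const
  have hcomp : IsCompact (Metric.closedBall x₀ 1 ×ˢ uIcc a b) :=
    (isCompact_closedBall x₀ 1).prod isCompact_uIcc
  obtain ⟨C, hC⟩ := hcomp.exists_bound_of_continuousOn hcont.continuousOn
  refine intervalIntegral.hasFDerivAt_integral_of_dominated_of_fderiv_le
    (F' := fun x t => (fderiv ℝ k (x, t)).comp (ContinuousLinearMap.inl ℝ E ℝ))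
    (bound := fun _ => C) (Metric.closedBall_mem_nhds x₀ one_pos) ?_ ?_ ?_ ?_ ?_ ?_
  · exact Eventually.of_forall fun x =>
      (hk.continuous.comp (Continuous.prodMk_right x)).aestronglyMeasurable
  · exact (hk.continuous.comp (Continuous.prodMk_right x₀)).intervalIntegrable _ _
  · exact (hcont.comp (Continuous.prodMk_right x₀)).aestronglyMeasurable
  · exact Eventually.of_forall fun t ht x hx => hC (x, t) ⟨hx, uIoc_subset_uIcc ht⟩
  · exact intervalIntegrable_const
  · refine Eventually.of_forall fun t _ x _ => ?_
    have h1 : HasFDerivAt k (fderiv ℝ k (x, t)) (x, t) :=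
      (hk.differentiable (by norm_num) _).hasFDerivAt
    exact h1.comp x (hasFDerivAt_prodMk_left x t)

/-- The integral of a smooth function over a compact interval depends smoothly on parameters. -/
theorem contDiff_intervalIntegral {E F : Type} [NormedAddCommGroup E]
    [NormedSpace ℝ E] [FiniteDimensional ℝ E] [NormedAddCommGroup F] [NormedSpace ℝ F]
    {k : E × ℝ → F} (hk : ContDiff ℝ ∞ k) (a b : ℝ) :
    ContDiff ℝ ∞ (fun x => ∫ t in a..b, k (x, t)) := by
  rw [contDiff_infty]
  intro n
  -- The derivative is again a parameter integral, now with values in `E →L[ℝ] F`, so `F` has to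
  -- vary in the induction.
  induction n generalizing F with
  | zero =>
    refine contDiff_zero.2 (continuous_iff_continuousAt.2 fun x => ?_)
    exact (hasFDerivAt_intervalIntegral_of_contDiff (hk.of_le (by exact_mod_cast le_top))
      a b x).continuousAt
  | succ n ih =>
    refine contDiff_succ_iff_hasFDerivAt.2 ⟨_, ?_, fun x =>
      hasFDerivAt_intervalIntegral_of_contDiff (hk.of_le (by exact_mod_cast le_top)) a b x⟩
    refine ih (k := fun p => (fderiv ℝ k p).comp (ContinuousLinearMap.inl ℝ E ℝ)) ?_
    exact ((contDiff_infty_iff_fderiv.1 hk).2).clm_comp contDiff_const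

/-- A function smooth near a point agrees near that point with a globally smooth function. -/
theorem exists_contDiff_eqOn_ball {E F : Type*} [NormedAddCommGroup E]
    [NormedSpace ℝ E] [FiniteDimensional ℝ E] [NormedAddCommGroup F] [NormedSpace ℝ F]
    {K : E → F} {W : Set E} (hW : IsOpen W) {x : E} (hx : x ∈ W) (hK : ContDiffOn ℝ ∞ K W) :
    ∃ K' : E → F, ContDiff ℝ ∞ K' ∧ ∃ r > 0, Metric.ball x r ⊆ W ∧
      EqOn K' K (Metric.ball x r) := by
  obtain ⟨r, hr, hrW⟩ := Metric.isOpen_iff.1 hW x hx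
  let b : ContDiffBump x := ⟨r / 4, r / 2, by positivity, by linarith⟩
  refine ⟨fun y => b y • K y, ?_, r / 4, by positivity,
    (Metric.ball_subset_ball (by linarith)).trans hrW, fun y hy => ?_⟩
  · refine contDiff_iff_contDiffAt.2 fun y => ?_
    by_cases hy : y ∈ tsupport fun y => b y • K y
    swap
    · exact contDiffAt_const.congr_of_eventuallyEq (notMem_tsupport_iff_eventuallyEq.1 hy)
    have hyb : y ∈ Metric.closedBall x (r / 2) := by
      have := closure_mono (Function.support_smul_subset_left b K) hy
      have h2 : tsupport b = Metric.closedBall x (r / 2) := b.tsupport_eq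
      rw [← h2]
      exact this
    have hyW : y ∈ W := hrW (Metric.closedBall_subset_ball (by linarith) hyb)
    exact b.contDiff.contDiffAt.smul (hK.contDiffAt (hW.mem_nhds hyW))
  · have : b y = 1 := b.one_of_mem_closedBall (Metric.ball_subset_closedBall hy)
    simp [this]

/-- Second order Hadamard lemma in the last coordinate: if `∂f/∂z = z K`, then
`f(x,y,z) = f(x,y,0) + z² H(x,y,z)` with `H` smooth. -/
theorem exists_eq_add_sq_mul {f K : (Fin 3 → ℝ) → ℝ} {W : Set (Fin 3 → ℝ)} (hW : IsOpen W)
    (h0 : (0 : Fin 3 → ℝ) ∈ W) (hf : DifferentiableOn ℝ f W) (hK : ContDiffOn ℝ ∞ K W)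
    (hfK : ∀ q ∈ W, fderiv ℝ f q (Pi.single 2 1) = q 2 * K q) :
    ∃ H : (Fin 3 → ℝ) → ℝ, ContDiff ℝ ∞ H ∧ H 0 = K 0 / 2 ∧ ∃ r > 0, Metric.ball 0 r ⊆ W ∧
      ∀ q ∈ Metric.ball (0 : Fin 3 → ℝ) r,
        f q = f ![q 0, q 1, 0] + q 2 ^ 2 * H q := by
  obtain ⟨K', hK', r, hr, hrW, hKK⟩ := exists_contDiff_eqOn_ball hW h0 hK
  have hpath : ContDiff ℝ ∞ fun p : (Fin 3 → ℝ) × ℝ => ![p.1 0, p.1 1, p.2 * p.1 2] := by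
    refine contDiff_pi.2 fun i => ?_
    fin_cases i <;> simp <;> fun_prop
  -- `H` comes from integrating `d/ds f(x, y, s z) = z · (s z) K(x, y, s z)` over `[0, 1]`; the
  -- weight `s` has integral `1/2`, hence `H 0 = K 0 / 2`.
  refine ⟨fun q => ∫ s in (0 : ℝ)..1, s * K' ![q 0, q 1, s * q 2], ?_, ?_, r, hr, hrW, ?_⟩
  · exact contDiff_intervalIntegral (k := fun p : (Fin 3 → ℝ) × ℝ =>
      p.2 * K' ![p.1 0, p.1 1, p.2 * p.1 2]) (contDiff_snd.mul (hK'.comp hpath)) 0 1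
  · have : (![0, 0, 0] : Fin 3 → ℝ) = 0 := by ext i; fin_cases i <;> rfl
    simp [this, hKK (Metric.mem_ball_self hr)]
    ring
  · intro q hq
    have hq' : ∀ s ∈ Icc (0 : ℝ) 1, ![q 0, q 1, s * q 2] ∈ Metric.ball (0 : Fin 3 → ℝ) r := by
      intro s hs
      rw [mem_ball_zero_iff, pi_norm_lt_iff hr] at hq ⊢
      intro i
      fin_cases i
      · exact hq 0
      · exact hq 1
      · have h2 := hq 2
        simp only [Fin.reduceFinMk, Matrix.cons_val, norm_mul]
        calc ‖s‖ * ‖q 2‖ ≤ 1 * ‖q 2‖ := by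
              gcongr
              rw [Real.norm_eq_abs, abs_le]
              constructor <;> linarith [hs.1, hs.2]
          _ < r := by simpa using h2
    have hder : ∀ s ∈ uIcc (0 : ℝ) 1, HasDerivAt (fun s => f ![q 0, q 1, s * q 2])
        (q 2 ^ 2 * (s * K' ![q 0, q 1, s * q 2])) s := by
      intro s hs
      rw [uIcc_of_le zero_le_one] at hs
      have hmem := hq' s hs
      have h1 : HasFDerivAt f (fderiv ℝ f ![q 0, q 1, s * q 2]) ![q 0, q 1, s * q 2] :=
        ((hf _ (hrW hmem)).differentiableAt (hW.mem_nhds (hrW hmem))).hasFDerivAt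
      have h2 : HasDerivAt (fun s : ℝ => ![q 0, q 1, s * q 2]) (q 2 • Pi.single 2 1) s := by
        rw [hasDerivAt_pi]
        intro i
        fin_cases i
        · simpa using hasDerivAt_const s (q 0)
        · simpa using hasDerivAt_const s (q 1)
        · simpa using (hasDerivAt_id s).mul_const (q 2)
      have h3 := h1.comp_hasDerivAt s h2
      rw [map_smul, hfK _ (hrW hmem), ← hKK hmem] at h3
      refine h3.congr_deriv ?_
      change q 2 * (s * q 2 * _) = _
      ring
    have hint : IntervalIntegrable
        (fun s => q 2 ^ 2 * (s * K' ![q 0, q 1, s * q 2])) MeasureTheory.volume 0 1 := by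
      refine Continuous.intervalIntegrable ?_ _ _
      exact continuous_const.mul (continuous_id.mul (hK'.continuous.comp
        (hpath.continuous.comp (Continuous.prodMk_right q))))
    have hmain := intervalIntegral.integral_eq_sub_of_hasDerivAt hder hint
    rw [intervalIntegral.integral_const_mul] at hmain
    have hq3 : ![q 0, q 1, q 2] = q := by ext i; fin_cases i <;> rfl
    simp only [one_mul, zero_mul, hq3] at hmain
    linarith

/-! ### Coefficients of the characteristic polynomial in terms of the entries. -/

theorem Matrix.charpoly_fin_three_eq {R : Type*} [CommRing R] (M : Matrix (Fin 3) (Fin 3) R) :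
    M.charpoly = Polynomial.X ^ 3 + Polynomial.C (-(M 0 0 + M 1 1 + M 2 2)) * Polynomial.X ^ 2
      + Polynomial.C (M 0 0 * M 1 1 - M 0 1 * M 1 0 + (M 0 0 * M 2 2 - M 0 2 * M 2 0)
        + (M 1 1 * M 2 2 - M 1 2 * M 2 1)) * Polynomial.X + Polynomial.C (-M.det) := by
  rw [Matrix.charpoly, Matrix.det_fin_three, Matrix.det_fin_three]
  simp only [Matrix.charmatrix_apply, Matrix.diagonal_apply, Fin.isValue, Fin.reduceEq, if_true,
    if_false, map_add, map_sub, map_neg, map_mul]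
  ring

theorem Polynomial.coeff_monic_cubic {R : Type*} [CommRing R] (a b c : R) :
    (X ^ 3 + C a * X ^ 2 + C b * X + C c).coeff 2 = a ∧
    (X ^ 3 + C a * X ^ 2 + C b * X + C c).coeff 1 = b ∧
    (X ^ 3 + C a * X ^ 2 + C b * X + C c).coeff 0 = c := by
  simp only [coeff_add, coeff_C_mul, coeff_X_pow, coeff_X, coeff_C]
  simp

theorem LinearMap.charpoly_eq_charpoly_toMatrix' (f : (Fin 3 → ℝ) →ₗ[ℝ] (Fin 3 → ℝ)) :
    f.charpoly = (LinearMap.toMatrix' f).charpoly := by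
  rw [← LinearMap.toMatrix_eq_toMatrix', LinearMap.charpoly_toMatrix]

section Coefficients

variable (L : (Fin 3 → ℝ) → (Fin 3 → ℝ) →L[ℝ] (Fin 3 → ℝ)) (p : Fin 3 → ℝ)

/-- The entry `L p i j` of the operator field in the standard coordinates. -/
def entry (i j : Fin 3) (p : Fin 3 → ℝ) : ℝ := L p (Pi.single j 1) i

theorem toMatrix'_eq_entry (i j : Fin 3) :
    LinearMap.toMatrix' (L p : (Fin 3 → ℝ) →ₗ[ℝ] (Fin 3 → ℝ)) i j = entry L i j p := by
  simp [LinearMap.toMatrix'_apply, entry]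

theorem charpoly_eq_entry :
    (L p : (Fin 3 → ℝ) →ₗ[ℝ] (Fin 3 → ℝ)).charpoly =
      Polynomial.X ^ 3
      + Polynomial.C (-(entry L 0 0 p + entry L 1 1 p + entry L 2 2 p)) * Polynomial.X ^ 2
      + Polynomial.C (entry L 0 0 p * entry L 1 1 p - entry L 0 1 p * entry L 1 0 p
        + (entry L 0 0 p * entry L 2 2 p - entry L 0 2 p * entry L 2 0 p)
        + (entry L 1 1 p * entry L 2 2 p - entry L 1 2 p * entry L 2 1 p)) * Polynomial.X
      + Polynomial.C (-(entry L 0 0 p * entry L 1 1 p * entry L 2 2 p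
        - entry L 0 0 p * entry L 1 2 p * entry L 2 1 p
        - entry L 0 1 p * entry L 1 0 p * entry L 2 2 p
        + entry L 0 1 p * entry L 1 2 p * entry L 2 0 p
        + entry L 0 2 p * entry L 1 0 p * entry L 2 1 p
        - entry L 0 2 p * entry L 1 1 p * entry L 2 0 p)) := by
  rw [LinearMap.charpoly_eq_charpoly_toMatrix', Matrix.charpoly_fin_three_eq,
    Matrix.det_fin_three]
  simp only [toMatrix'_eq_entry]

theorem sigma_one_eq : sigma L 1 = fun p => -(entry L 0 0 p + entry L 1 1 p + entry L 2 2 p) := by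
  funext p
  rw [sigma, charpoly_eq_entry]
  exact (Polynomial.coeff_monic_cubic _ _ _).1

theorem sigma_two_eq : sigma L 2 = fun p =>
    entry L 0 0 p * entry L 1 1 p - entry L 0 1 p * entry L 1 0 p
      + (entry L 0 0 p * entry L 2 2 p - entry L 0 2 p * entry L 2 0 p)
      + (entry L 1 1 p * entry L 2 2 p - entry L 1 2 p * entry L 2 1 p) := by
  funext p
  rw [sigma, charpoly_eq_entry]
  exact (Polynomial.coeff_monic_cubic _ _ _).2.1

theorem sigma_three_eq : sigma L 3 = fun p =>
    -(entry L 0 0 p * entry L 1 1 p * entry L 2 2 p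
      - entry L 0 0 p * entry L 1 2 p * entry L 2 1 p
      - entry L 0 1 p * entry L 1 0 p * entry L 2 2 p
      + entry L 0 1 p * entry L 1 2 p * entry L 2 0 p
      + entry L 0 2 p * entry L 1 0 p * entry L 2 1 p
      - entry L 0 2 p * entry L 1 1 p * entry L 2 0 p) := by
  funext p
  rw [sigma, charpoly_eq_entry]
  exact (Polynomial.coeff_monic_cubic _ _ _).2.2

theorem charpoly_eval_eq_sigma (t : ℝ) :
    (L p : (Fin 3 → ℝ) →ₗ[ℝ] (Fin 3 → ℝ)).charpoly.eval t =
      t ^ 3 + sigma L 1 p * t ^ 2 + sigma L 2 p * t + sigma L 3 p := by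
  rw [charpoly_eq_entry, sigma_one_eq, sigma_two_eq, sigma_three_eq]
  simp

end Coefficients

/-! ### The action of `L*` on the differentials of the coefficients. -/

section Nijenhuis

variable {L : (Fin 3 → ℝ) → (Fin 3 → ℝ) →L[ℝ] (Fin 3 → ℝ)} {U : Set (Fin 3 → ℝ)}
  {p : Fin 3 → ℝ}

theorem contDiffOn_entry (hL : ContDiffOn ℝ ∞ L U) (i j : Fin 3) :
    ContDiffOn ℝ ∞ (entry L i j) U :=
  contDiffOn_pi.1 (hL.clm_apply contDiffOn_const) i

theorem contDiffOn_sigma_one (hL : ContDiffOn ℝ ∞ L U) : ContDiffOn ℝ ∞ (sigma L 1) U := by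
  have h := contDiffOn_entry hL
  rw [sigma_one_eq]
  fun_prop

theorem contDiffOn_sigma_two (hL : ContDiffOn ℝ ∞ L U) : ContDiffOn ℝ ∞ (sigma L 2) U := by
  have h := contDiffOn_entry hL
  rw [sigma_two_eq]
  fun_prop

theorem contDiffOn_sigma_three (hL : ContDiffOn ℝ ∞ L U) : ContDiffOn ℝ ∞ (sigma L 3) U := by
  have h := contDiffOn_entry hL
  rw [sigma_three_eq]
  fun_prop

/-- The torsion on constant fields, in terms of the derivative of the operator field. -/
theorem nijenhuisTorsion_const {E : Type*} [NormedAddCommGroup E] [NormedSpace ℝ E]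
    {L : E → E →L[ℝ] E} {p : E} (hL : DifferentiableAt ℝ L p) (u v : E) :
    nijenhuisTorsion L (fun _ => u) (fun _ => v) p =
      fderiv ℝ L p (L p u) v - fderiv ℝ L p (L p v) u + L p (fderiv ℝ L p v u)
        - L p (fderiv ℝ L p u v) := by
  have h : ∀ w : E, HasFDerivAt (fun q => L q w) ((fderiv ℝ L p).flip w) p := fun w => by
    simpa using hL.hasFDerivAt.clm_apply (hasFDerivAt_const w p)
  simp only [nijenhuisTorsion, VectorField.lieBracket_eq, (h _).fderiv, fderiv_fun_const]
  simp

theorem hasFDerivAt_entry (hL : DifferentiableAt ℝ L p) (i j : Fin 3) :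
    HasFDerivAt (entry L i j)
      ((ContinuousLinearMap.proj i).comp ((fderiv ℝ L p).flip (Pi.single j 1))) p := by
  have h : HasFDerivAt (fun q => L q (Pi.single j 1)) ((fderiv ℝ L p).flip (Pi.single j 1)) p := by
    simpa using hL.hasFDerivAt.clm_apply (hasFDerivAt_const (Pi.single j (1 : ℝ)) p)
  exact hasFDerivAt_pi'.1 h i

theorem clm_eq_sum (A : (Fin 3 → ℝ) →L[ℝ] (Fin 3 → ℝ)) (v : Fin 3 → ℝ) (i : Fin 3) :
    A v i = A (Pi.single 0 1) i * v 0 + A (Pi.single 1 1) i * v 1 + A (Pi.single 2 1) i * v 2 := by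
  have hv : v = v 0 • Pi.single 0 1 + v 1 • Pi.single 1 1 + v 2 • Pi.single 2 1 := by
    ext k; fin_cases k <;> simp
  conv_lhs => rw [hv]
  simp only [map_add, map_smul, Pi.add_apply, Pi.smul_apply, smul_eq_mul]
  ring

/-- The vanishing of the torsion, in coordinates. -/
theorem IsNijenhuisOn.entry_relation (hU : IsOpen U) (hL : IsNijenhuisOn L U) (hp : p ∈ U)
    (i j k : Fin 3) :
    fderiv ℝ (entry L i k) p (L p (Pi.single j 1))
      - fderiv ℝ (entry L i j) p (L p (Pi.single k 1))
      + (entry L i 0 p * fderiv ℝ (entry L 0 j) p (Pi.single k 1)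
        + entry L i 1 p * fderiv ℝ (entry L 1 j) p (Pi.single k 1)
        + entry L i 2 p * fderiv ℝ (entry L 2 j) p (Pi.single k 1))
      - (entry L i 0 p * fderiv ℝ (entry L 0 k) p (Pi.single j 1)
        + entry L i 1 p * fderiv ℝ (entry L 1 k) p (Pi.single j 1)
        + entry L i 2 p * fderiv ℝ (entry L 2 k) p (Pi.single j 1)) = 0 := by
  have hd : DifferentiableAt ℝ L p :=
    (hL.smooth.contDiffAt (hU.mem_nhds hp)).differentiableAt (by simp)
  have h := congrFun (hL.torsion_eq_zero (fun _ => Pi.single j 1) (fun _ => Pi.single k 1)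
    contDiffOn_const contDiffOn_const p hp) i
  rw [nijenhuisTorsion_const hd] at h
  simp only [Pi.add_apply, Pi.sub_apply, Pi.zero_apply] at h
  rw [clm_eq_sum (L p) (fderiv ℝ L p (Pi.single k 1) (Pi.single j 1)),
    clm_eq_sum (L p) (fderiv ℝ L p (Pi.single j 1) (Pi.single k 1))] at h
  simp only [(hasFDerivAt_entry hd _ _).fderiv]
  simpa [entry] using h

theorem clm_apply_eq_sum {F : Type*} [NormedAddCommGroup F] [NormedSpace ℝ F]
    (A : (Fin 3 → ℝ) →L[ℝ] F) (v : Fin 3 → ℝ) :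
    A v = v 0 • A (Pi.single 0 1) + v 1 • A (Pi.single 1 1) + v 2 • A (Pi.single 2 1) := by
  have hv : v = v 0 • Pi.single 0 1 + v 1 • Pi.single 1 1 + v 2 • Pi.single 2 1 := by
    ext k; fin_cases k <;> simp
  conv_lhs => rw [hv]
  simp only [map_add, map_smul]

theorem clm_ext_single {F : Type*} [NormedAddCommGroup F] [NormedSpace ℝ F]
    {A B : (Fin 3 → ℝ) →L[ℝ] F} (h : ∀ j, A (Pi.single j 1) = B (Pi.single j 1)) : A = B := by
  ext v
  rw [clm_apply_eq_sum A, clm_apply_eq_sum B, h, h, h]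

theorem fderiv_entry_apply (i j k : Fin 3) :
    fderiv ℝ (entry L i j) p (L p (Pi.single k 1)) =
      entry L 0 k p * fderiv ℝ (entry L i j) p (Pi.single 0 1)
      + entry L 1 k p * fderiv ℝ (entry L i j) p (Pi.single 1 1)
      + entry L 2 k p * fderiv ℝ (entry L i j) p (Pi.single 2 1) := by
  rw [clm_apply_eq_sum (fderiv ℝ (entry L i j) p)]
  simp [entry]

theorem differentiableAt_entry (hU : IsOpen U) (hL : IsNijenhuisOn L U) (hp : p ∈ U)
    (i j : Fin 3) : DifferentiableAt ℝ (entry L i j) p :=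
  ((contDiffOn_entry hL.smooth i j).contDiffAt (hU.mem_nhds hp)).differentiableAt (by simp)

theorem fderiv_sigma_one (h : ∀ i j, DifferentiableAt ℝ (entry L i j) p) (u : Fin 3 → ℝ) :
    fderiv ℝ (sigma L 1) p u = -(fderiv ℝ (entry L 0 0) p u + fderiv ℝ (entry L 1 1) p u
      + fderiv ℝ (entry L 2 2) p u) := by
  have h' := fun i j => (h i j).hasFDerivAt
  have key := (((h' 0 0).add (h' 1 1)).add (h' 2 2)).neg
  rw [sigma_one_eq]
  refine (DFunLike.congr_fun key.fderiv u).trans ?_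
  simp

theorem fderiv_sigma_two (h : ∀ i j, DifferentiableAt ℝ (entry L i j) p) (u : Fin 3 → ℝ) :
    fderiv ℝ (sigma L 2) p u =
      (entry L 1 1 p + entry L 2 2 p) * fderiv ℝ (entry L 0 0) p u
      + (entry L 0 0 p + entry L 2 2 p) * fderiv ℝ (entry L 1 1) p u
      + (entry L 0 0 p + entry L 1 1 p) * fderiv ℝ (entry L 2 2) p u
      - (entry L 1 0 p * fderiv ℝ (entry L 0 1) p u + entry L 0 1 p * fderiv ℝ (entry L 1 0) p u)
      - (entry L 2 0 p * fderiv ℝ (entry L 0 2) p u + entry L 0 2 p * fderiv ℝ (entry L 2 0) p u)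
      - (entry L 2 1 p * fderiv ℝ (entry L 1 2) p u + entry L 1 2 p * fderiv ℝ (entry L 2 1) p u)
      := by
  have h' := fun i j => (h i j).hasFDerivAt
  have key := ((((h' 0 0).mul (h' 1 1)).sub ((h' 0 1).mul (h' 1 0))).add
    (((h' 0 0).mul (h' 2 2)).sub ((h' 0 2).mul (h' 2 0)))).add
    (((h' 1 1).mul (h' 2 2)).sub ((h' 1 2).mul (h' 2 1)))
  rw [sigma_two_eq]
  refine (DFunLike.congr_fun key.fderiv u).trans ?_
  simp
  ring

theorem fderiv_sigma_three (h : ∀ i j, DifferentiableAt ℝ (entry L i j) p) (u : Fin 3 → ℝ) :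
    fderiv ℝ (sigma L 3) p u = -(
      (entry L 1 1 p * entry L 2 2 p - entry L 1 2 p * entry L 2 1 p)
          * fderiv ℝ (entry L 0 0) p u
      + (entry L 1 2 p * entry L 2 0 p - entry L 1 0 p * entry L 2 2 p)
          * fderiv ℝ (entry L 0 1) p u
      + (entry L 1 0 p * entry L 2 1 p - entry L 1 1 p * entry L 2 0 p)
          * fderiv ℝ (entry L 0 2) p u
      + (entry L 0 2 p * entry L 2 1 p - entry L 0 1 p * entry L 2 2 p)
          * fderiv ℝ (entry L 1 0) p u
      + (entry L 0 0 p * entry L 2 2 p - entry L 0 2 p * entry L 2 0 p)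
          * fderiv ℝ (entry L 1 1) p u
      + (entry L 0 1 p * entry L 2 0 p - entry L 0 0 p * entry L 2 1 p)
          * fderiv ℝ (entry L 1 2) p u
      + (entry L 0 1 p * entry L 1 2 p - entry L 0 2 p * entry L 1 1 p)
          * fderiv ℝ (entry L 2 0) p u
      + (entry L 0 2 p * entry L 1 0 p - entry L 0 0 p * entry L 1 2 p)
          * fderiv ℝ (entry L 2 1) p u
      + (entry L 0 0 p * entry L 1 1 p - entry L 0 1 p * entry L 1 0 p)
          * fderiv ℝ (entry L 2 2) p u) := by
  have h' := fun i j => (h i j).hasFDerivAt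
  have m := fun a b c d e f => ((h' a b).mul (h' c d)).mul (h' e f)
  have key := ((((((m 0 0 1 1 2 2).sub (m 0 0 1 2 2 1)).sub (m 0 1 1 0 2 2)).add
    (m 0 1 1 2 2 0)).add (m 0 2 1 0 2 1)).sub (m 0 2 1 1 2 0)).neg
  rw [sigma_three_eq]
  refine (DFunLike.congr_fun key.fderiv u).trans ?_
  simp
  ring

/-- `L* dσ₁ = dσ₂ - σ₁ dσ₁` for a Nijenhuis operator. -/
theorem IsNijenhuisOn.fderiv_sigma_one_comp (hU : IsOpen U) (hL : IsNijenhuisOn L U)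
    (hp : p ∈ U) : (fderiv ℝ (sigma L 1) p).comp (L p) =
      fderiv ℝ (sigma L 2) p - sigma L 1 p • fderiv ℝ (sigma L 1) p := by
  have h := differentiableAt_entry hU hL hp
  refine clm_ext_single fun j => ?_
  have r := fun i k => hL.entry_relation hU hp i j k
  simp only [fderiv_entry_apply] at r
  simp only [ContinuousLinearMap.comp_apply, _root_.sub_apply,
    _root_.smul_apply, smul_eq_mul, fderiv_sigma_one h, fderiv_sigma_two h,
    fderiv_entry_apply]
  simp only [sigma_one_eq]
  -- The weight of `r i k`, here and for `σ₂`, `σ₃`, is the partial derivative of the coefficient in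
  -- the entry `(i, k)`. These weights form the transpose of a polynomial `P` in `L`; since `P L = L
  -- P`, the two middle groups of torsion terms cancel, leaving `dσ(L e_j) = tr(P L ∂_j L)`. Here `P
  -- = -1`.
  linear_combination -(r 0 0 + r 1 1 + r 2 2)

/-- `L* dσ₂ = dσ₃ - σ₂ dσ₁` for a Nijenhuis operator. -/
theorem IsNijenhuisOn.fderiv_sigma_two_comp (hU : IsOpen U) (hL : IsNijenhuisOn L U)
    (hp : p ∈ U) : (fderiv ℝ (sigma L 2) p).comp (L p) =
      fderiv ℝ (sigma L 3) p - sigma L 2 p • fderiv ℝ (sigma L 1) p := by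
  have h := differentiableAt_entry hU hL hp
  refine clm_ext_single fun j => ?_
  have r := fun i k => hL.entry_relation hU hp i j k
  simp only [fderiv_entry_apply] at r
  simp only [ContinuousLinearMap.comp_apply, _root_.sub_apply,
    _root_.smul_apply, smul_eq_mul, fderiv_sigma_one h, fderiv_sigma_two h,
    fderiv_sigma_three h, fderiv_entry_apply]
  simp only [sigma_two_eq]
  linear_combination (entry L 1 1 p + entry L 2 2 p) * r 0 0
    + (entry L 0 0 p + entry L 2 2 p) * r 1 1 + (entry L 0 0 p + entry L 1 1 p) * r 2 2
    - entry L 1 0 p * r 0 1 - entry L 0 1 p * r 1 0 - entry L 2 0 p * r 0 2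
    - entry L 0 2 p * r 2 0 - entry L 2 1 p * r 1 2 - entry L 1 2 p * r 2 1

/-- `L* dσ₃ = -σ₃ dσ₁` for a Nijenhuis operator. -/
theorem IsNijenhuisOn.fderiv_sigma_three_comp (hU : IsOpen U) (hL : IsNijenhuisOn L U)
    (hp : p ∈ U) : (fderiv ℝ (sigma L 3) p).comp (L p) =
      -(sigma L 3 p • fderiv ℝ (sigma L 1) p) := by
  have h := differentiableAt_entry hU hL hp
  refine clm_ext_single fun j => ?_
  have r := fun i k => hL.entry_relation hU hp i j k
  simp only [fderiv_entry_apply] at r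
  simp only [ContinuousLinearMap.comp_apply, _root_.neg_apply,
    _root_.smul_apply, smul_eq_mul, fderiv_sigma_one h,
    fderiv_sigma_three h, fderiv_entry_apply]
  simp only [sigma_three_eq]
  -- Here `P = -adj L`, so `P L = -det L = σ₃` is scalar.
  linear_combination -(
      (entry L 1 1 p * entry L 2 2 p - entry L 1 2 p * entry L 2 1 p) * r 0 0
      + (entry L 1 2 p * entry L 2 0 p - entry L 1 0 p * entry L 2 2 p) * r 0 1
      + (entry L 1 0 p * entry L 2 1 p - entry L 1 1 p * entry L 2 0 p) * r 0 2
      + (entry L 0 2 p * entry L 2 1 p - entry L 0 1 p * entry L 2 2 p) * r 1 0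
      + (entry L 0 0 p * entry L 2 2 p - entry L 0 2 p * entry L 2 0 p) * r 1 1
      + (entry L 0 1 p * entry L 2 0 p - entry L 0 0 p * entry L 2 1 p) * r 1 2
      + (entry L 0 1 p * entry L 1 2 p - entry L 0 2 p * entry L 1 1 p) * r 2 0
      + (entry L 0 2 p * entry L 1 0 p - entry L 0 0 p * entry L 1 2 p) * r 2 1
      + (entry L 0 0 p * entry L 1 1 p - entry L 0 1 p * entry L 1 0 p) * r 2 2)

end Nijenhuis

/-! ### The common kernel of two independent forms, via the cross product. -/

section KernelVector

open Matrix

/-- The coefficient vector of a linear form on `ℝ³`. -/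
def coeffVector (A : (Fin 3 → ℝ) →L[ℝ] ℝ) : Fin 3 → ℝ := fun i => A (Pi.single i 1)

/-- A vector annihilated by two linear forms on `ℝ³`: the cross product of their coefficients. -/
def kernelVector (A B : (Fin 3 → ℝ) →L[ℝ] ℝ) : Fin 3 → ℝ := coeffVector A ⨯₃ coeffVector B

theorem apply_eq_coeffVector_dot (A : (Fin 3 → ℝ) →L[ℝ] ℝ) (v : Fin 3 → ℝ) :
    A v = coeffVector A ⬝ᵥ v := by
  rw [clm_apply_eq_sum A v]
  simp [coeffVector, dotProduct, Fin.sum_univ_three, mul_comm]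

theorem kernelVector_ne_zero {A B : (Fin 3 → ℝ) →L[ℝ] ℝ} (h : LinearIndependent ℝ ![A, B]) :
    kernelVector A B ≠ 0 := by
  rw [kernelVector, crossProduct_ne_zero_iff_linearIndependent, LinearIndependent.pair_iff]
  intro s t hst
  refine LinearIndependent.pair_iff.1 h s t (clm_ext_single fun j => ?_)
  simpa [coeffVector] using congrFun hst j

/-- The common kernel of two independent forms on `ℝ³` is spanned by their `kernelVector`. -/
theorem dot_smul_eq_dot_smul_kernelVector {A B : (Fin 3 → ℝ) →L[ℝ] ℝ} {v : Fin 3 → ℝ}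
    (hA : A v = 0) (hB : B v = 0) :
    (kernelVector A B ⬝ᵥ kernelVector A B) • v = (v ⬝ᵥ kernelVector A B) • kernelVector A B := by
  rw [apply_eq_coeffVector_dot] at hA hB
  have h1 : kernelVector A B ⨯₃ v = 0 := by
    rw [kernelVector, cross_cross_eq_smul_sub_smul]
    simp [hA, hB]
  -- With `n` the kernel vector, `n × v = 0`; expanding `n × (n × v)` gives the claim.
  have h2 := cross_cross_eq_smul_sub_smul' (kernelVector A B) (kernelVector A B) v
  rw [h1] at h2
  simp only [map_zero] at h2
  rw [dotProduct_comm v]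
  exact (sub_eq_zero.1 h2.symm).symm

/-- The factor is an explicit quotient of scalar products, so it inherits differentiability when the
forms and the vector vary. -/
theorem exists_eq_smul_kernelVector {A B : (Fin 3 → ℝ) →L[ℝ] ℝ}
    (h : LinearIndependent ℝ ![A, B]) {v : Fin 3 → ℝ} (hA : A v = 0) (hB : B v = 0) :
    v = ((v ⬝ᵥ kernelVector A B) / (kernelVector A B ⬝ᵥ kernelVector A B)) •
      kernelVector A B := by
  have h0 : kernelVector A B ⬝ᵥ kernelVector A B ≠ 0 := by
    simpa using kernelVector_ne_zero h
  rw [div_eq_inv_mul, mul_smul, ← dot_smul_eq_dot_smul_kernelVector hA hB, smul_smul,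
    inv_mul_cancel₀ h0, one_smul]

theorem contDiffOn_kernelVector {W : Set (Fin 3 → ℝ)} {A B : (Fin 3 → ℝ) → (Fin 3 → ℝ) →L[ℝ] ℝ}
    (hA : ContDiffOn ℝ ∞ A W) (hB : ContDiffOn ℝ ∞ B W) :
    ContDiffOn ℝ ∞ (fun p => kernelVector (A p) (B p)) W := by
  have hA' : ∀ i, ContDiffOn ℝ ∞ (fun p => A p (Pi.single i 1)) W := fun i =>
    hA.clm_apply contDiffOn_const
  have hB' : ∀ i, ContDiffOn ℝ ∞ (fun p => B p (Pi.single i 1)) W := fun i =>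
    hB.clm_apply contDiffOn_const
  refine contDiffOn_pi.2 fun i => ?_
  fin_cases i <;> simp only [kernelVector, cross_apply, coeffVector] <;>
    exact ((hA' _).mul (hB' _)).sub ((hA' _).mul (hB' _))

end KernelVector

/-! ### Smooth charts and coordinate vector fields. -/

/-- The inverse function theorem for smooth maps of a finite dimensional space: an immersive
point of a smooth map is in the source of a smooth local chart given by the map. -/
theorem exists_chart {E : Type*} [NormedAddCommGroup E] [NormedSpace ℝ E] [FiniteDimensional ℝ E]
    {Φ : E → E} {W : Set E} (hW : IsOpen W) {p : E} (hp : p ∈ W) (hΦ : ContDiffOn ℝ ∞ Φ W)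
    (hinj : Function.Injective (fderiv ℝ Φ p)) :
    ∃ φ : OpenPartialHomeomorph E E, p ∈ φ.source ∧ φ.source ⊆ W ∧ (φ : E → E) = Φ ∧
      ContDiffOn ℝ ∞ φ.symm φ.target := by
  have : CompleteSpace E := FiniteDimensional.complete ℝ E
  have heq : ∀ {A : E →L[ℝ] E}, Function.Injective A → ∃ e : E ≃L[ℝ] E, (e : E →L[ℝ] E) = A :=
    fun {A} hA => ⟨(LinearEquiv.ofInjectiveEndo (A : E →ₗ[ℝ] E) hA).toContinuousLinearEquiv,
      by ext; rfl⟩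
  obtain ⟨e, he⟩ := heq hinj
  have hat : ∀ {q}, q ∈ W → ContDiffAt ℝ ∞ Φ q := fun hq => hΦ.contDiffAt (hW.mem_nhds hq)
  have hder : ∀ {q}, q ∈ W → HasFDerivAt Φ (fderiv ℝ Φ q) q := fun hq =>
    ((hat hq).differentiableAt (by simp)).hasFDerivAt
  have hd : HasFDerivAt Φ (e : E →L[ℝ] E) p := he ▸ hder hp
  -- The inverse is smooth only where the derivative is invertible, so the chart is cut down to this
  -- set, open because the invertible maps are.
  let V : Set E := W ∩ fderiv ℝ Φ ⁻¹' range ContinuousLinearEquiv.toContinuousLinearMap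
  have hV : IsOpen V := by
    refine ContinuousOn.isOpen_inter_preimage ?_ hW ContinuousLinearEquiv.isOpen
    exact (hΦ.fderiv_of_isOpen (m := ∞) hW (by simp)).continuousOn
  let ψ := (hat hp).toOpenPartialHomeomorph Φ hd (by simp)
  have hps : p ∈ ψ.source := (hat hp).mem_toOpenPartialHomeomorph_source hd (by simp)
  refine ⟨ψ.restrOpen V hV, ⟨hps, hp, e, he⟩, fun q hq => hq.2.1, rfl, fun q hq => ?_⟩
  have hs := (ψ.restrOpen V hV).map_target hq
  obtain ⟨e', he'⟩ : _ ∈ range _ := hs.2.2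
  refine (OpenPartialHomeomorph.contDiffAt_symm (f₀' := e') _ hq ?_
    (hat hs.2.1)).contDiffWithinAt
  exact he' ▸ hder hs.2.1

/-- Applied to basis vectors: the images of `Pi.single j 1` under `fderiv ℝ φ.symm q` are the
coordinate fields of `φ`, on which the forms `dφ_i` take the values `δ_ij`. This reads off
coefficients of forms and columns of matrices. -/
theorem fderiv_chart_fderiv_symm {E : Type*} [NormedAddCommGroup E] [NormedSpace ℝ E]
    {φ : OpenPartialHomeomorph E E} (h : ContDiffOn ℝ ∞ φ φ.source)
    (h' : ContDiffOn ℝ ∞ φ.symm φ.target) {q : E} (hq : q ∈ φ.target) (v : E) :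
    fderiv ℝ φ (φ.symm q) (fderiv ℝ φ.symm q v) = v := by
  have h1 : HasFDerivAt φ.symm (fderiv ℝ φ.symm q) q :=
    ((h'.contDiffAt (φ.open_target.mem_nhds hq)).differentiableAt (by simp)).hasFDerivAt
  have h2 : HasFDerivAt φ (fderiv ℝ φ (φ.symm q)) (φ.symm q) :=
    ((h.contDiffAt (φ.open_source.mem_nhds (φ.map_target hq))).differentiableAt
      (by simp)).hasFDerivAt
  have h3 : HasFDerivAt (φ ∘ φ.symm) (ContinuousLinearMap.id ℝ E) q :=
    (hasFDerivAt_id q).congr_of_eventuallyEq (by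
      filter_upwards [φ.open_target.mem_nhds hq] with x hx using φ.right_inv hx)
  exact DFunLike.congr_fun ((h2.comp q h1).unique h3) v

theorem hasFDerivAt_coord (i : Fin 3) (q : Fin 3 → ℝ) :
    HasFDerivAt (fun q : Fin 3 → ℝ => q i)
      (ContinuousLinearMap.proj i : (Fin 3 → ℝ) →L[ℝ] ℝ) q :=
  (ContinuousLinearMap.proj i : (Fin 3 → ℝ) →L[ℝ] ℝ).hasFDerivAt

/-! ### The Morse lemma with parameters. -/

section Morse

open Matrix

variable {U W : Set (Fin 3 → ℝ)} {f g s : (Fin 3 → ℝ) → ℝ}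

/-- The derivative of `s` along the common level curves of `f` and `g`. -/
noncomputable def levelDerivative (f g s : (Fin 3 → ℝ) → ℝ) (p : Fin 3 → ℝ) : ℝ :=
  fderiv ℝ s p (kernelVector (fderiv ℝ f p) (fderiv ℝ g p))

theorem contDiffOn_levelDerivative (hW : IsOpen W) (hf : ContDiffOn ℝ ∞ f W)
    (hg : ContDiffOn ℝ ∞ g W) (hs : ContDiffOn ℝ ∞ s W) :
    ContDiffOn ℝ ∞ (levelDerivative f g s) W :=
  (hs.fderiv_of_isOpen (m := ∞) hW (by simp)).clm_apply (contDiffOn_kernelVector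
    (hf.fderiv_of_isOpen (m := ∞) hW (by simp)) (hg.fderiv_of_isOpen (m := ∞) hW (by simp)))

/-- At a Morse singularity of `s` on the curve `f = g = 0`, the derivative of `s` along the level
curves of `f` and `g` has a simple zero. -/
theorem HasMorseSingularityOnCurve.levelDerivative_simple_zero {p₀ : Fin 3 → ℝ} (hW : IsOpen W)
    (h0 : p₀ ∈ W) (hf : ContDiffOn ℝ ∞ f W) (hg : ContDiffOn ℝ ∞ g W)
    (hs : ContDiffOn ℝ ∞ s W)
    (hind : ∀ p ∈ W, LinearIndependent ℝ ![fderiv ℝ f p, fderiv ℝ g p])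
    (hM : HasMorseSingularityOnCurve s {p | p ∈ U ∧ f p = 0 ∧ g p = 0} p₀) :
    levelDerivative f g s p₀ = 0 ∧
      levelDerivative f g (levelDerivative f g s) p₀ ≠ 0 := by
  obtain ⟨γ, δ, hδ, hγ, hmaps, hγ0, hv, hcrit, hnd⟩ := hM
  have hmem0 : (0 : ℝ) ∈ Ioo (-δ) δ := ⟨by linarith, hδ⟩
  have hγat : ∀ {t}, t ∈ Ioo (-δ) δ → ContDiffAt ℝ ∞ γ t := fun ht =>
    hγ.contDiffAt (isOpen_Ioo.mem_nhds ht)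
  have hγd : ∀ {t}, t ∈ Ioo (-δ) δ → HasDerivAt γ (deriv γ t) t := fun ht =>
    ((hγat ht).differentiableAt (by simp)).hasDerivAt
  have hdiff : ∀ {k : (Fin 3 → ℝ) → ℝ}, ContDiffOn ℝ ∞ k W → ∀ {p}, p ∈ W →
      HasFDerivAt k (fderiv ℝ k p) p := fun {k} hk {p} hp =>
    ((hk.contDiffAt (hW.mem_nhds hp)).differentiableAt (by simp)).hasFDerivAt
  have hnear : ∀ᶠ t in 𝓝 (0 : ℝ), t ∈ Ioo (-δ) δ ∧ γ t ∈ W :=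
    (isOpen_Ioo.eventually_mem hmem0).and ((hγat hmem0).continuousAt.eventually_mem (by
      rw [hγ0]; exact hW.mem_nhds h0))
  let V : (Fin 3 → ℝ) → Fin 3 → ℝ := fun p => kernelVector (fderiv ℝ f p) (fderiv ℝ g p)
  -- `f` and `g` vanish along `γ`, so `γ' = lam V`. Then `(s ∘ γ)' = lam · V(s)`, and where `V(s) =
  -- 0` the second derivative is `lam² · V(V(s))`.
  let lam : ℝ → ℝ := fun t => (deriv γ t ⬝ᵥ V (γ t)) / (V (γ t) ⬝ᵥ V (γ t))
  have hzero : ∀ {k : (Fin 3 → ℝ) → ℝ}, ContDiffOn ℝ ∞ k W →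
      (∀ t ∈ Ioo (-δ) δ, k (γ t) = 0) → ∀ {t}, t ∈ Ioo (-δ) δ → γ t ∈ W →
      fderiv ℝ k (γ t) (deriv γ t) = 0 := by
    intro k hk hk0 t ht htW
    have h1 := (hdiff hk htW).comp_hasDerivAt t (hγd ht)
    have h2 : HasDerivAt (k ∘ γ) 0 t := (hasDerivAt_const t (0 : ℝ)).congr_of_eventuallyEq (by
      filter_upwards [isOpen_Ioo.mem_nhds ht] with r hr using hk0 r hr)
    exact h1.unique h2
  have hlam : ∀ {t}, t ∈ Ioo (-δ) δ → γ t ∈ W → deriv γ t = lam t • V (γ t) := fun ht htW =>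
    exists_eq_smul_kernelVector (hind _ htW) (hzero hf (fun r hr => (hmaps hr).2.1) ht htW)
      (hzero hg (fun r hr => (hmaps hr).2.2) ht htW)
  have hderiv : deriv (s ∘ γ) =ᶠ[𝓝 0] fun t => lam t * levelDerivative f g s (γ t) := by
    filter_upwards [hnear] with t ht
    rw [((hdiff hs ht.2).comp_hasDerivAt t (hγd ht.1)).deriv, hlam ht.1 ht.2, map_smul]
    rfl
  have hW0 : γ 0 ∈ W := hγ0 ▸ h0
  have hlam0 : lam 0 ≠ 0 := by
    intro h
    apply hv
    rw [hlam hmem0 hW0, h, zero_smul]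
  have hL0 : levelDerivative f g s p₀ = 0 := by
    have h := hderiv.self_of_nhds
    simp only [hcrit, hγ0] at h
    exact (mul_eq_zero.1 h.symm).resolve_left hlam0
  refine ⟨hL0, fun hbad => hnd ?_⟩
  have hV : ContDiffOn ℝ ∞ V W := contDiffOn_kernelVector
    (hf.fderiv_of_isOpen (m := ∞) hW (by simp)) (hg.fderiv_of_isOpen (m := ∞) hW (by simp))
  have hVγ : ContDiffAt ℝ ∞ (fun t => V (γ t)) 0 :=
    (hV.contDiffAt (hW.mem_nhds hW0)).comp 0 (hγat hmem0)
  have hγ' : ContDiffAt ℝ ∞ (deriv γ) 0 :=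
    (hγ.deriv_of_isOpen (m := ∞) isOpen_Ioo (by simp)).contDiffAt (isOpen_Ioo.mem_nhds hmem0)
  have hdot : ∀ {a b : ℝ → Fin 3 → ℝ}, ContDiffAt ℝ ∞ a 0 → ContDiffAt ℝ ∞ b 0 →
      ContDiffAt ℝ ∞ (fun t => a t ⬝ᵥ b t) 0 := fun ha hb =>
    ContDiffAt.sum fun i _ => (contDiffAt_pi.1 ha i).mul (contDiffAt_pi.1 hb i)
  have hlamd : DifferentiableAt ℝ lam 0 := by
    refine ((hdot hγ' hVγ).div (hdot hVγ hVγ) ?_).differentiableAt (by simp)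
    simpa using kernelVector_ne_zero (hind _ hW0)
  have hcomp := (hdiff (contDiffOn_levelDerivative hW hf hg hs) hW0).comp_hasDerivAt 0 (hγd hmem0)
  have hprod := hlamd.hasDerivAt.mul hcomp
  rw [iteratedDeriv_succ, iteratedDeriv_one, hderiv.deriv_eq]
  refine hprod.deriv.trans ?_
  have hbad' : fderiv ℝ (levelDerivative f g s) (γ 0) (V (γ 0)) = 0 := by
    rw [hγ0]; exact hbad
  rw [hlam hmem0 hW0, map_smul, hbad']
  simp [hγ0, hL0]

theorem fderiv_vec3_injective {a b c : (Fin 3 → ℝ) → ℝ} {p : Fin 3 → ℝ}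
    (ha : DifferentiableAt ℝ a p) (hb : DifferentiableAt ℝ b p) (hc : DifferentiableAt ℝ c p)
    (h : ∀ v, fderiv ℝ a p v = 0 → fderiv ℝ b p v = 0 → fderiv ℝ c p v = 0 → v = 0) :
    Function.Injective (fderiv ℝ (fun q => ![a q, b q, c q]) p) := by
  refine (injective_iff_map_eq_zero _).2 fun v hv => ?_
  have hd : HasFDerivAt (fun q => ![a q, b q, c q])
      (ContinuousLinearMap.pi ![fderiv ℝ a p, fderiv ℝ b p, fderiv ℝ c p]) p := by
    refine hasFDerivAt_pi.2 fun i => ?_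
    fin_cases i
    exacts [ha.hasFDerivAt, hb.hasFDerivAt, hc.hasFDerivAt]
  rw [hd.fderiv] at hv
  exact h v (congrFun hv 0) (congrFun hv 1) (congrFun hv 2)

theorem contDiffOn_vec3 {a b c : (Fin 3 → ℝ) → ℝ} (ha : ContDiffOn ℝ ∞ a W)
    (hb : ContDiffOn ℝ ∞ b W) (hc : ContDiffOn ℝ ∞ c W) :
    ContDiffOn ℝ ∞ (fun q => ![a q, b q, c q]) W := by
  refine contDiffOn_pi.2 fun i => ?_
  fin_cases i
  exacts [ha, hb, hc]

/-- The Morse lemma with parameters, in the form that adapts the coordinates `(x, y, z)` to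
`x = f`, `y = g`, `s = G(x, y) ± z²`. -/
theorem exists_morse_chart (hW : IsOpen W) (h0 : (0 : Fin 3 → ℝ) ∈ W)
    (hf : ContDiffOn ℝ ∞ f W) (hg : ContDiffOn ℝ ∞ g W) (hs : ContDiffOn ℝ ∞ s W)
    (hind : ∀ p ∈ W, LinearIndependent ℝ ![fderiv ℝ f p, fderiv ℝ g p])
    (hf0 : f 0 = 0) (hg0 : g 0 = 0)
    (hM : HasMorseSingularityOnCurve s {p | p ∈ U ∧ f p = 0 ∧ g p = 0} 0) :
    ∃ (ε : ℝ) (φ : OpenPartialHomeomorph (Fin 3 → ℝ) (Fin 3 → ℝ)) (G : (Fin 3 → ℝ) → ℝ) (r : ℝ),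
      (ε = 1 ∨ ε = -1) ∧ 0 < r ∧ 0 ∈ φ.source ∧ φ.source ⊆ W ∧ φ 0 = 0 ∧
      ContDiffOn ℝ ∞ φ φ.source ∧ ContDiffOn ℝ ∞ φ.symm φ.target ∧
      ContDiffOn ℝ ∞ G (Metric.ball 0 r) ∧ (∀ q, G q = G ![q 0, q 1, 0]) ∧
      ∀ p ∈ φ.source, φ p 0 = f p ∧ φ p 1 = g p ∧ s p = G (φ p) + ε * φ p 2 ^ 2 := by
  have hdiff : ∀ {k : (Fin 3 → ℝ) → ℝ}, ContDiffOn ℝ ∞ k W → ∀ {p}, p ∈ W →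
      DifferentiableAt ℝ k p := fun {k} hk {p} hp =>
    (hk.contDiffAt (hW.mem_nhds hp)).differentiableAt (by simp)
  obtain ⟨hw0, hw1⟩ := hM.levelDerivative_simple_zero hW h0 hf hg hs hind
  have hw := contDiffOn_levelDerivative hW hf hg hs
  set w := levelDerivative f g s with hwdef
  -- The third coordinate is `w = V(s)` itself, so the critical points of `s` on the level curves
  -- are exactly `w = 0` and need not be solved for.
  obtain ⟨ψ, hψ0, hψW, hψ, hψs⟩ := exists_chart hW h0 (contDiffOn_vec3 hf hg hw) (by
    refine fderiv_vec3_injective (hdiff hf h0) (hdiff hg h0) (hdiff hw h0) fun v h1 h2 h3 => ?_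
    rw [exists_eq_smul_kernelVector (hind 0 h0) h1 h2, map_smul, smul_eq_mul, mul_eq_zero] at h3
    rw [exists_eq_smul_kernelVector (hind 0 h0) h1 h2, h3.resolve_right hw1, zero_smul])
  have hψW' : ∀ q ∈ ψ.target, ψ.symm q ∈ W := fun q hq => hψW (ψ.map_target hq)
  have hψsm : ContDiffOn ℝ ∞ ψ ψ.source := by
    rw [hψ]; exact (contDiffOn_vec3 hf hg hw).mono hψW
  have hψ00 : ψ 0 = 0 := by
    rw [hψ]; simp [hf0, hg0, hw0]
  have ht0 : (0 : Fin 3 → ℝ) ∈ ψ.target := hψ00 ▸ ψ.map_source hψ0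
  let n : (Fin 3 → ℝ) → Fin 3 → ℝ := fun q => fderiv ℝ ψ.symm q (Pi.single 2 1)
  have hn : ∀ q ∈ ψ.target, fderiv ℝ f (ψ.symm q) (n q) = 0 ∧ fderiv ℝ g (ψ.symm q) (n q) = 0 ∧
      fderiv ℝ w (ψ.symm q) (n q) = 1 := by
    intro q hq
    have h1 := fderiv_chart_fderiv_symm hψsm hψs hq (Pi.single 2 1)
    have hd : HasFDerivAt ψ (fderiv ℝ ψ (ψ.symm q)) (ψ.symm q) :=
      ((hψsm.contDiffAt (ψ.open_source.mem_nhds (ψ.map_target hq))).differentiableAt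
        (by simp)).hasFDerivAt
    have hd' := hasFDerivAt_pi'.1 hd
    rw [hψ] at hd'
    have e0 : fderiv ℝ f (ψ.symm q) = _ := HasFDerivAt.fderiv (hd' 0)
    have e1 : fderiv ℝ g (ψ.symm q) = _ := HasFDerivAt.fderiv (hd' 1)
    have e2 : fderiv ℝ w (ψ.symm q) = _ := HasFDerivAt.fderiv (hd' 2)
    rw [e0, e1, e2, ← hψ]
    simp only [ContinuousLinearMap.comp_apply, ContinuousLinearMap.proj_apply, n, h1]
    simp
  let F : (Fin 3 → ℝ) → ℝ := fun q => s (ψ.symm q)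
  have hF : ContDiffOn ℝ ∞ F ψ.target := hs.comp hψs hψW'
  -- In this chart `∂/∂w = V / V(w)`, so `∂s/∂w = V(s) / V(w) = w K` with `K = 1 / V(w)`.
  let K : (Fin 3 → ℝ) → ℝ := fun q => (levelDerivative f g w (ψ.symm q))⁻¹
  have hlevel : ∀ q ∈ ψ.target, ∃ l : ℝ,
      n q = l • kernelVector (fderiv ℝ f (ψ.symm q)) (fderiv ℝ g (ψ.symm q)) ∧
      l * levelDerivative f g w (ψ.symm q) = 1 := by
    intro q hq
    obtain ⟨h1, h2, h3⟩ := hn q hq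
    have h4 := exists_eq_smul_kernelVector (hind _ (hψW' q hq)) h1 h2
    refine ⟨_, h4, ?_⟩
    rw [h4, map_smul] at h3
    exact h3
  have hKne : ∀ q ∈ ψ.target, levelDerivative f g w (ψ.symm q) ≠ 0 := by
    intro q hq h
    obtain ⟨l, -, h1⟩ := hlevel q hq
    simp [h] at h1
  have hK : ContDiffOn ℝ ∞ K ψ.target :=
    ((contDiffOn_levelDerivative hW hf hg hw).comp hψs hψW').inv hKne
  have hFK : ∀ q ∈ ψ.target, fderiv ℝ F q (Pi.single 2 1) = q 2 * K q := by
    intro q hq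
    have hd : HasFDerivAt ψ.symm (fderiv ℝ ψ.symm q) q :=
      ((hψs.contDiffAt (ψ.open_target.mem_nhds hq)).differentiableAt (by simp)).hasFDerivAt
    have h1 : fderiv ℝ F q = _ :=
      HasFDerivAt.fderiv ((hdiff hs (hψW' q hq)).hasFDerivAt.comp q hd)
    obtain ⟨l, hl, hl1⟩ := hlevel q hq
    have h2 : q 2 = w (ψ.symm q) := by
      conv_lhs => rw [← ψ.right_inv hq, hψ]
      rfl
    rw [h1, ContinuousLinearMap.comp_apply]
    change fderiv ℝ s (ψ.symm q) (n q) = _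
    rw [hl, map_smul, h2, smul_eq_mul, mul_comm]
    congr 1
    exact eq_inv_of_mul_eq_one_left hl1
  obtain ⟨H, hH, hH0, r, hr, hrt, hFH⟩ := exists_eq_add_sq_mul ψ.open_target ht0
    (hF.differentiableOn (by simp)) hK hFK
  have hK0 : K 0 ≠ 0 := inv_ne_zero (hKne 0 ht0)
  obtain ⟨ε, hε, hεH⟩ : ∃ ε : ℝ, (ε = 1 ∨ ε = -1) ∧ 0 < ε * H 0 := by
    rw [hH0]
    rcases lt_or_gt_of_ne hK0 with h | h
    · exact ⟨-1, Or.inr rfl, by linarith⟩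
    · exact ⟨1, Or.inl rfl, by linarith⟩
  let W' : Set (Fin 3 → ℝ) := Metric.ball 0 r ∩ {q | 0 < ε * H q}
  have hW' : IsOpen W' := Metric.isOpen_ball.inter
    (isOpen_lt continuous_const (continuous_const.mul hH.continuous))
  have h0W' : (0 : Fin 3 → ℝ) ∈ W' := ⟨Metric.mem_ball_self hr, hεH⟩
  have hsqrt : ContDiffOn ℝ ∞ (fun q => √(ε * H q)) W' := fun q hq =>
    ((contDiffAt_const.mul hH.contDiffAt).sqrt hq.2.ne').contDiffWithinAt
  have hc : ∀ (i : Fin 3) {S : Set (Fin 3 → ℝ)}, ContDiffOn ℝ ∞ (fun q : Fin 3 → ℝ => q i) S :=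
    fun i S => (contDiff_apply ℝ ℝ i).contDiffOn
  -- The new coordinate is `z = w √(ε H)`, with `ε` the sign of `H 0`: since `ε² = 1`, `ε z² = w²
  -- H`.
  have hZ : ContDiffOn ℝ ∞ (fun q => q 2 * √(ε * H q)) W' := (hc 2).mul hsqrt
  have hZ' : HasFDerivAt (fun q : Fin 3 → ℝ => q 2 * √(ε * H q))
      (√(ε * H 0) • (ContinuousLinearMap.proj 2 : (Fin 3 → ℝ) →L[ℝ] ℝ)) 0 := by
    have h2 := ((hsqrt.contDiffAt (hW'.mem_nhds h0W')).differentiableAt (by simp)).hasFDerivAt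
    exact ((hasFDerivAt_coord 2 0).mul h2).congr_fderiv (by simp)
  obtain ⟨χ, hχ0, hχW, hχ, hχs⟩ := exists_chart hW' h0W' (contDiffOn_vec3 (hc 0) (hc 1) hZ) (by
    refine fderiv_vec3_injective (a := fun q => q 0) (b := fun q => q 1)
      (by fun_prop) (by fun_prop) hZ'.differentiableAt fun v h1 h2 h3 => ?_
    have hproj : ∀ i : Fin 3, fderiv ℝ (fun q : Fin 3 → ℝ => q i) 0 = ContinuousLinearMap.proj i :=
      fun i => (hasFDerivAt_coord i 0).fderiv
    rw [hproj] at h1 h2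
    rw [hZ'.fderiv] at h3
    have h3' : √(ε * H 0) * v 2 = 0 := h3
    have h4 := (mul_eq_zero.1 h3').resolve_left (Real.sqrt_pos.2 hεH).ne'
    ext i
    fin_cases i
    exacts [h1, h2, h4])
  have hχsm : ContDiffOn ℝ ∞ χ χ.source := by
    rw [hχ]; exact (contDiffOn_vec3 (hc 0) (hc 1) hZ).mono hχW
  have hproj : ContDiff ℝ ∞ fun q : Fin 3 → ℝ => ![q 0, q 1, 0] := by
    refine contDiff_pi.2 fun i => ?_
    fin_cases i <;> simp <;> fun_prop
  refine ⟨ε, ψ.trans χ, fun q => F ![q 0, q 1, 0], r, hε, hr, ?_, ?_, ?_, ?_, ?_, ?_, ?_, ?_⟩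
  · rw [OpenPartialHomeomorph.trans_source]
    exact ⟨hψ0, by simpa [hψ00] using hχ0⟩
  · rw [OpenPartialHomeomorph.trans_source]
    exact fun p hp => hψW hp.1
  · rw [OpenPartialHomeomorph.coe_trans, Function.comp_apply, hψ00, hχ]
    simp
  · rw [OpenPartialHomeomorph.trans_source]
    exact hχsm.comp (hψsm.mono inter_subset_left) fun p hp => hp.2
  · rw [OpenPartialHomeomorph.trans_target]
    exact hψs.comp (hχs.mono inter_subset_left) fun p hp => hp.2
  · refine hF.comp hproj.contDiffOn fun q hq => hrt ?_
    rw [mem_ball_zero_iff, pi_norm_lt_iff hr] at hq ⊢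
    intro i
    fin_cases i
    exacts [hq 0, hq 1, by simpa using hr]
  · simp
  · intro p hp
    rw [OpenPartialHomeomorph.trans_source] at hp
    have hq : ψ p ∈ W' := hχW hp.2
    have hsp : s p = F (ψ p) := by simp only [F, ψ.left_inv hp.1]
    have hεε : ε * ε = 1 := by rcases hε with rfl | rfl <;> norm_num
    have hval : χ (ψ p) = ![ψ p 0, ψ p 1, ψ p 2 * √(ε * H (ψ p))] := by rw [hχ]
    rw [OpenPartialHomeomorph.coe_trans, Function.comp_apply, hval, hsp, hFH _ hq.1]
    refine ⟨by rw [hψ]; rfl, by rw [hψ]; rfl, ?_⟩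
    simp only [Matrix.cons_val]
    rw [mul_pow, Real.sq_sqrt hq.2.le]
    linear_combination (-(ψ p 2 ^ 2) * H (ψ p)) * hεε

end Morse

/-! ### The Clairaut-type equation for `G`. -/

theorem eq_cbrt_of_pow_three_eq {a c : ℝ} (h : a ^ 3 = c) : a = cbrt c := by
  have h3 : Odd 3 := by decide
  exact h3.strictMono_pow.injective (h.trans (cbrt_pow_three c).symm)

/-- A function `G` of `(x, y)` with `G_x = -G_y²` and `G = G_y³ - x G_y² + y G_y` is affine
near `0`. -/
theorem eq_affine_of_clairaut {G : (Fin 3 → ℝ) → ℝ} {r : ℝ} (hr : 0 < r)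
    (hG : ContDiffOn ℝ ∞ G (Metric.ball 0 r))
    (hx : ∀ q ∈ Metric.ball (0 : Fin 3 → ℝ) r,
      fderiv ℝ G q (Pi.single 0 1) = -fderiv ℝ G q (Pi.single 1 1) ^ 2)
    (hz : ∀ q ∈ Metric.ball (0 : Fin 3 → ℝ) r, fderiv ℝ G q (Pi.single 2 1) = 0)
    (h : ∀ q ∈ Metric.ball (0 : Fin 3 → ℝ) r,
      G q = fderiv ℝ G q (Pi.single 1 1) ^ 3 - q 0 * fderiv ℝ G q (Pi.single 1 1) ^ 2
        + q 1 * fderiv ℝ G q (Pi.single 1 1)) :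
    ∃ ρ > 0, ρ ≤ r ∧ ∀ q ∈ Metric.ball (0 : Fin 3 → ℝ) ρ,
      fderiv ℝ G q (Pi.single 1 1) = cbrt (G 0) ∧
      G q = cbrt (G 0) * q 1 - cbrt (G 0) ^ 2 * q 0 + G 0 := by
  have hball := Metric.isOpen_ball (x := (0 : Fin 3 → ℝ)) (ε := r)
  have h0 : (0 : Fin 3 → ℝ) ∈ Metric.ball (0 : Fin 3 → ℝ) r := Metric.mem_ball_self hr
  let B : (Fin 3 → ℝ) → ℝ := fun q => fderiv ℝ G q (Pi.single 1 1)
  have hB : ContDiffOn ℝ ∞ B (Metric.ball 0 r) :=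
    (hG.fderiv_of_isOpen (m := ∞) hball (by simp)).clm_apply contDiffOn_const
  have hdB : ContDiffOn ℝ ∞ (fderiv ℝ B) (Metric.ball 0 r) :=
    hB.fderiv_of_isOpen (m := ∞) hball (by simp)
  have hBd : ∀ q ∈ Metric.ball (0 : Fin 3 → ℝ) r, HasFDerivAt B (fderiv ℝ B q) q := fun q hq =>
    ((hB.contDiffAt (hball.mem_nhds hq)).differentiableAt (by simp)).hasFDerivAt
  -- Differentiating `G = B³ - x B² + y B` and cancelling `dG = -B² dx + B dy` leaves this factor
  -- times `dB`.
  have hfactor : ∀ q ∈ Metric.ball (0 : Fin 3 → ℝ) r,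
      3 * B q ^ 2 - 2 * q 0 * B q + q 1 ≠ 0 → fderiv ℝ B q = 0 := by
    intro q hq hne
    have h1 := (((hBd q hq).pow 3).sub ((hasFDerivAt_coord 0 q).mul ((hBd q hq).pow 2))).add
      ((hasFDerivAt_coord 1 q).mul (hBd q hq))
    have h2 := h1.congr_of_eventuallyEq (f₁ := G) (by
      filter_upwards [hball.mem_nhds hq] with q' hq' using h q' hq')
    ext v
    have h3 := DFunLike.congr_fun h2.fderiv v
    rw [clm_apply_eq_sum, hx q hq, hz q hq] at h3
    simp at h3
    have h4 : (3 * B q ^ 2 - 2 * q 0 * B q + q 1) * fderiv ℝ B q v = 0 := by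
      have h5 : fderiv ℝ G q (Pi.single 1 1) = B q := rfl
      rw [h5] at h3
      linear_combination -h3
    exact (mul_eq_zero.1 h4).resolve_left hne
  have hcont : ∀ i : Fin 3, ContinuousAt (fun q : Fin 3 → ℝ => q i) 0 := fun i =>
    (continuous_apply i).continuousAt
  have hBc : ContinuousAt B 0 := (hB.contDiffAt (hball.mem_nhds h0)).continuousAt
  have hconst : ∀ᶠ q in 𝓝 (0 : Fin 3 → ℝ), fderiv ℝ B q = 0 := by
    -- If `B 0 ≠ 0` the factor is nonzero near `0`. If `B 0 = 0` it vanishes at `0`, but its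
    -- `y`-derivative `(6 B - 2 x) B_y + 1` equals `1` there. At a nearby point with `dB ≠ 0` the
    -- factor would vanish on a neighborhood, and so would this derivative.
    by_cases hB0 : B 0 = 0
    · have hdBc : ContinuousAt (fun q => fderiv ℝ B q (Pi.single 1 1)) 0 :=
        (hdB.contDiffAt (hball.mem_nhds h0)).continuousAt.clm_apply continuousAt_const
      have hk : ContinuousAt
          (fun q : Fin 3 → ℝ => (6 * B q - 2 * q 0) * fderiv ℝ B q (Pi.single 1 1) + 1) 0 :=
        (((continuousAt_const.mul hBc).sub (continuousAt_const.mul (hcont 0))).mul hdBc).add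
          continuousAt_const
      have hk' := hk.eventually_ne (y := 0) (by simp [hB0])
      filter_upwards [hk', hball.mem_nhds h0] with q hq hqr
      by_contra hne
      have hev := ((hdB.contDiffAt (hball.mem_nhds hqr)).continuousAt).eventually_ne hne
      have h1 := ((((hBd q hqr).pow 2).const_mul 3).sub
        (((hasFDerivAt_coord 0 q).const_mul 2).mul (hBd q hqr))).add (hasFDerivAt_coord 1 q)
      have h2 := (hasFDerivAt_const (𝕜 := ℝ) (0 : ℝ) q).congr_of_eventuallyEq
        (f₁ := fun q => 3 * B q ^ 2 - 2 * q 0 * B q + q 1) (by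
        filter_upwards [hev, hball.mem_nhds hqr] with q' h3 h4
        by_contra h5
        exact h3 (hfactor q' h4 h5))
      have h3 := DFunLike.congr_fun (h1.unique h2) (Pi.single 1 1)
      simp at h3
      apply hq
      linear_combination h3
    · have hk : ContinuousAt (fun q : Fin 3 → ℝ => 3 * B q ^ 2 - 2 * q 0 * B q + q 1) 0 :=
        ((continuousAt_const.mul (hBc.pow 2)).sub
          ((continuousAt_const.mul (hcont 0)).mul hBc)).add (hcont 1)
      have hk' := hk.eventually_ne (y := 0) (by simp [hB0])
      filter_upwards [hk', hball.mem_nhds h0] with q hq hqr using hfactor q hqr hq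
  obtain ⟨ρ, hρ, hρB⟩ := Metric.eventually_nhds_iff_ball.1 hconst
  have hm : 0 < min ρ r := lt_min hρ hr
  have hsub : Metric.ball (0 : Fin 3 → ℝ) (min ρ r) ⊆ Metric.ball 0 r :=
    Metric.ball_subset_ball (min_le_right _ _)
  have hBeq : ∀ q ∈ Metric.ball (0 : Fin 3 → ℝ) (min ρ r), B q = B 0 := by
    intro q hq
    refine Metric.isOpen_ball.is_const_of_fderiv_eq_zero (𝕜 := ℝ)
      (convex_ball _ _).isPreconnected ?_ ?_ hq (Metric.mem_ball_self hm)
    · exact (hB.mono hsub).differentiableOn (by simp)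
    · exact fun q' hq' => hρB q' (Metric.ball_subset_ball (min_le_left _ _) hq')
  have hB0 : B 0 = cbrt (G 0) := by
    refine eq_cbrt_of_pow_three_eq ?_
    have := h 0 h0
    simpa using this.symm
  refine ⟨min ρ r, hm, min_le_right _ _, fun q hq => ?_⟩
  have h1 : fderiv ℝ G q (Pi.single 1 1) = cbrt (G 0) := (hBeq q hq).trans hB0
  refine ⟨h1, ?_⟩
  rw [h q (hsub hq), h1]
  linear_combination cbrt_pow_three (G 0)

/-! ### The relations for `L*` in coordinates with `σ₃ = G(x, y) + ε z²`. -/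

section AdaptedChart

variable {U : Set (Fin 3 → ℝ)} {L : (Fin 3 → ℝ) → (Fin 3 → ℝ) →L[ℝ] (Fin 3 → ℝ)}
  {φ : OpenPartialHomeomorph (Fin 3 → ℝ) (Fin 3 → ℝ)} {G : (Fin 3 → ℝ) → ℝ} {ε r : ℝ}

theorem hasFDerivAt_chart_apply (hφ : ContDiffOn ℝ ∞ φ φ.source) {p : Fin 3 → ℝ}
    (hp : p ∈ φ.source) (i : Fin 3) :
    HasFDerivAt (fun p => φ p i) ((ContinuousLinearMap.proj i).comp (fderiv ℝ φ p)) p :=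
  hasFDerivAt_pi'.1 ((hφ.contDiffAt (φ.open_source.mem_nhds hp)).differentiableAt
    (by simp)).hasFDerivAt i

theorem fderiv_eq_of_eqOn_chart (hφ : ContDiffOn ℝ ∞ φ φ.source) {s : (Fin 3 → ℝ) → ℝ}
    {i : Fin 3} (hs : ∀ p ∈ φ.source, φ p i = s p) {p : Fin 3 → ℝ} (hp : p ∈ φ.source)
    (v : Fin 3 → ℝ) : fderiv ℝ s p v = fderiv ℝ φ p v i :=
  DFunLike.congr_fun ((hasFDerivAt_chart_apply hφ hp i).congr_of_eventuallyEq (by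
    filter_upwards [φ.open_source.mem_nhds hp] with q hq using (hs q hq).symm)).fderiv v

theorem fderiv_eq_of_eq_comp_chart_add_sq (hφ : ContDiffOn ℝ ∞ φ φ.source)
    {s : (Fin 3 → ℝ) → ℝ} (hs : ∀ p ∈ φ.source, s p = G (φ p) + ε * φ p 2 ^ 2)
    {p : Fin 3 → ℝ} (hp : p ∈ φ.source) (hG : DifferentiableAt ℝ G (φ p)) (v : Fin 3 → ℝ) :
    fderiv ℝ s p v = fderiv ℝ G (φ p) (fderiv ℝ φ p v)
      + ε * (2 * φ p 2 * fderiv ℝ φ p v 2) := by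
  have h1 : HasFDerivAt φ (fderiv ℝ φ p) p :=
    ((hφ.contDiffAt (φ.open_source.mem_nhds hp)).differentiableAt (by simp)).hasFDerivAt
  have h2 := (hG.hasFDerivAt.comp p h1).add
    (((hasFDerivAt_chart_apply hφ hp 2).pow 2).const_mul ε)
  refine (DFunLike.congr_fun (h2.congr_of_eventuallyEq (f₁ := s) (by
    filter_upwards [φ.open_source.mem_nhds hp] with q hq using hs q hq)).fderiv v).trans ?_
  simp

/-- Since `G` ignores `z`, identities for its derivatives obtained on `z = 0` extend to all `z`. -/
theorem fderiv_of_eq_comp_proj (hG : ContDiffOn ℝ ∞ G (Metric.ball 0 r))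
    (hGproj : ∀ q, G q = G ![q 0, q 1, 0]) {q : Fin 3 → ℝ} (hq : q ∈ Metric.ball 0 r)
    (v : Fin 3 → ℝ) : fderiv ℝ G q v = fderiv ℝ G ![q 0, q 1, 0] ![v 0, v 1, 0] := by
  have hr : 0 < r := Metric.pos_of_mem_ball hq
  have hq' : ![q 0, q 1, 0] ∈ Metric.ball (0 : Fin 3 → ℝ) r := by
    rw [mem_ball_zero_iff, pi_norm_lt_iff hr] at hq ⊢
    intro i
    fin_cases i
    exacts [hq 0, hq 1, by simpa using hr]
  let P : (Fin 3 → ℝ) →L[ℝ] (Fin 3 → ℝ) := ContinuousLinearMap.pi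
    ![ContinuousLinearMap.proj 0, ContinuousLinearMap.proj 1, 0]
  have hP : ∀ v, P v = ![v 0, v 1, 0] := by
    intro v; ext i; fin_cases i <;> rfl
  have h1 : HasFDerivAt G (fderiv ℝ G (P q)) (P q) := by
    rw [hP]
    exact ((hG.contDiffAt (Metric.isOpen_ball.mem_nhds hq')).differentiableAt
      (by simp)).hasFDerivAt
  have h2 := (h1.comp q P.hasFDerivAt).congr_of_eventuallyEq (f₁ := G)
    (Eventually.of_forall fun q => by rw [Function.comp_apply, hP, ← hGproj])
  rw [h2.fderiv, ContinuousLinearMap.comp_apply, hP, hP]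

/-- The relation `L* dσ₃ = -σ₃ dσ₁` in coordinates with `x = σ₁`, `y = σ₂`,
`σ₃ = G(x, y) + ε z²`. -/
theorem IsNijenhuisOn.chart_relation (hU : IsOpen U) (hL : IsNijenhuisOn L U)
    (hφU : φ.source ⊆ U) (hφ : ContDiffOn ℝ ∞ φ φ.source)
    (h1 : ∀ p ∈ φ.source, φ p 0 = sigma L 1 p) (h2 : ∀ p ∈ φ.source, φ p 1 = sigma L 2 p)
    (h3 : ∀ p ∈ φ.source, sigma L 3 p = G (φ p) + ε * φ p 2 ^ 2)
    (hG : ContDiffOn ℝ ∞ G (Metric.ball 0 r)) (hGproj : ∀ q, G q = G ![q 0, q 1, 0])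
    {p : Fin 3 → ℝ} (hp : p ∈ φ.source) (hpr : φ p ∈ Metric.ball 0 r) (v : Fin 3 → ℝ) :
    fderiv ℝ φ p (L p v) 0 = fderiv ℝ φ p v 1 - φ p 0 * fderiv ℝ φ p v 0 ∧
    fderiv ℝ φ p (L p v) 1 = fderiv ℝ G (φ p) (Pi.single 0 1) * fderiv ℝ φ p v 0
      + fderiv ℝ G (φ p) (Pi.single 1 1) * fderiv ℝ φ p v 1
      + 2 * ε * φ p 2 * fderiv ℝ φ p v 2 - φ p 1 * fderiv ℝ φ p v 0 ∧
    fderiv ℝ G (φ p) (Pi.single 0 1) * fderiv ℝ φ p (L p v) 0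
      + fderiv ℝ G (φ p) (Pi.single 1 1) * fderiv ℝ φ p (L p v) 1
      + 2 * ε * φ p 2 * fderiv ℝ φ p (L p v) 2 =
        -((G (φ p) + ε * φ p 2 ^ 2) * fderiv ℝ φ p v 0) := by
  have hGd : DifferentiableAt ℝ G (φ p) :=
    (hG.contDiffAt (Metric.isOpen_ball.mem_nhds hpr)).differentiableAt (by simp)
  have hz : fderiv ℝ G (φ p) (Pi.single 2 1) = 0 := by
    rw [fderiv_of_eq_comp_proj hG hGproj hpr]
    have : (![0, 0, 0] : Fin 3 → ℝ) = 0 := by ext i; fin_cases i <;> rfl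
    simp [this]
  have r1 := DFunLike.congr_fun (hL.fderiv_sigma_one_comp hU (hφU hp)) v
  have r2 := DFunLike.congr_fun (hL.fderiv_sigma_two_comp hU (hφU hp)) v
  have r3 := DFunLike.congr_fun (hL.fderiv_sigma_three_comp hU (hφU hp)) v
  simp only [ContinuousLinearMap.comp_apply, _root_.sub_apply, _root_.smul_apply,
    _root_.neg_apply, smul_eq_mul, fderiv_eq_of_eqOn_chart hφ h1 hp,
    fderiv_eq_of_eqOn_chart hφ h2 hp, fderiv_eq_of_eq_comp_chart_add_sq hφ h3 hp hGd,
    ← h1 p hp, ← h2 p hp, h3 p hp] at r1 r2 r3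
  rw [clm_apply_eq_sum (fderiv ℝ G (φ p)), hz] at r2 r3
  simp only [smul_eq_mul] at r2 r3
  refine ⟨r1, ?_, ?_⟩
  · linear_combination r2
  · linear_combination r3

/-- In the adapted coordinates the function `G` is affine near `0`. -/
theorem IsNijenhuisOn.exists_affine (hU : IsOpen U) (hL : IsNijenhuisOn L U)
    (hφU : φ.source ⊆ U) (hφ : ContDiffOn ℝ ∞ φ φ.source)
    (hφs : ContDiffOn ℝ ∞ φ.symm φ.target) (h0 : 0 ∈ φ.target)
    (h1 : ∀ p ∈ φ.source, φ p 0 = sigma L 1 p) (h2 : ∀ p ∈ φ.source, φ p 1 = sigma L 2 p)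
    (h3 : ∀ p ∈ φ.source, sigma L 3 p = G (φ p) + ε * φ p 2 ^ 2) (hr : 0 < r)
    (hG : ContDiffOn ℝ ∞ G (Metric.ball 0 r)) (hGproj : ∀ q, G q = G ![q 0, q 1, 0]) :
    ∃ ρ > 0, ρ ≤ r ∧ ∀ q ∈ Metric.ball (0 : Fin 3 → ℝ) ρ,
      fderiv ℝ G q (Pi.single 0 1) = -cbrt (G 0) ^ 2 ∧
      fderiv ℝ G q (Pi.single 1 1) = cbrt (G 0) ∧
      G q = cbrt (G 0) * q 1 - cbrt (G 0) ^ 2 * q 0 + G 0 := by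
  obtain ⟨ρ, hρ, hρt⟩ := Metric.isOpen_iff.1 φ.open_target 0 h0
  have hm : 0 < min ρ r := lt_min hρ hr
  have hsub : Metric.ball (0 : Fin 3 → ℝ) (min ρ r) ⊆ Metric.ball 0 r :=
    Metric.ball_subset_ball (min_le_right _ _)
  have hvec : (![0, 0, 0] : Fin 3 → ℝ) = 0 := by ext i; fin_cases i <;> rfl
  have hvec0 : (![1, 0, 0] : Fin 3 → ℝ) = Pi.single 0 1 := by ext i; fin_cases i <;> rfl
  have hvec1 : (![0, 1, 0] : Fin 3 → ℝ) = Pi.single 1 1 := by ext i; fin_cases i <;> rfl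
  have key : ∀ q ∈ Metric.ball (0 : Fin 3 → ℝ) (min ρ r),
      fderiv ℝ G q (Pi.single 0 1) = -fderiv ℝ G q (Pi.single 1 1) ^ 2 ∧
      G q = fderiv ℝ G q (Pi.single 1 1) ^ 3 - q 0 * fderiv ℝ G q (Pi.single 1 1) ^ 2
        + q 1 * fderiv ℝ G q (Pi.single 1 1) := by
    intro q hq
    have hq' : ![q 0, q 1, 0] ∈ Metric.ball (0 : Fin 3 → ℝ) (min ρ r) := by
      rw [mem_ball_zero_iff, pi_norm_lt_iff hm] at hq ⊢
      intro i
      fin_cases i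
      exacts [hq 0, hq 1, by simpa using hm]
    have hA : fderiv ℝ G q (Pi.single 0 1) = fderiv ℝ G ![q 0, q 1, 0] (Pi.single 0 1) := by
      rw [fderiv_of_eq_comp_proj hG hGproj (hsub hq)]
      simp [hvec0]
    have hB : fderiv ℝ G q (Pi.single 1 1) = fderiv ℝ G ![q 0, q 1, 0] (Pi.single 1 1) := by
      rw [fderiv_of_eq_comp_proj hG hGproj (hsub hq)]
      simp [hvec1]
    have ht : ![q 0, q 1, 0] ∈ φ.target :=
      hρt (Metric.ball_subset_ball (min_le_left _ _) hq')
    have hinv := φ.right_inv ht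
    have rel := fun j => hL.chart_relation hU hφU hφ h1 h2 h3 hG hGproj (φ.map_target ht)
      (by rw [hinv]; exact hsub hq') (fderiv ℝ φ.symm ![q 0, q 1, 0] (Pi.single j 1))
    simp only [fderiv_chart_fderiv_symm hφ hφs ht] at rel
    -- The `dx` and `dy` coefficients at a point with `z = 0`, where the terms containing the
    -- unknown third row of `L` drop out.
    have hc0 := rel 0
    have hc1 := rel 1
    simp only [hinv, ← hA, ← hB, ← hGproj q] at hc0 hc1
    simp at hc0 hc1
    obtain ⟨a0, b0, e0⟩ := hc0
    obtain ⟨a1, b1, e1⟩ := hc1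
    rw [a0, b0] at e0
    rw [a1, b1] at e1
    have hx : fderiv ℝ G q (Pi.single 0 1) = -fderiv ℝ G q (Pi.single 1 1) ^ 2 := by
      linear_combination e1
    refine ⟨hx, ?_⟩
    rw [hx] at e0
    linear_combination e0
  obtain ⟨ρ', hρ', hle, hfin⟩ := eq_affine_of_clairaut hm (hG.mono hsub)
    (fun q hq => (key q hq).1) (fun q hq => by
      rw [fderiv_of_eq_comp_proj hG hGproj (hsub hq)]
      simp [hvec]) (fun q hq => (key q hq).2)
  refine ⟨ρ', hρ', hle.trans (min_le_right _ _), fun q hq => ?_⟩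
  obtain ⟨hB, hGq⟩ := hfin q hq
  refine ⟨?_, hB, hGq⟩
  rw [(key q (Metric.ball_subset_ball hle hq)).1, hB]

end AdaptedChart

/-! ### The third row and the normal form. -/

/-- If the product of a real function with one having nonzero derivative vanishes near a zero of
the latter, the former vanishes there. -/
theorem eq_zero_of_mul_eventuallyEq_zero {E : Type*} [NormedAddCommGroup E] [NormedSpace ℝ E]
    {Z η : E → ℝ} {Z' : E →L[ℝ] ℝ} {p v : E} (hZ : HasFDerivAt Z Z' p)
    (hη : DifferentiableAt ℝ η p) (h : ∀ᶠ q in 𝓝 p, Z q * η q = 0) (hp : Z p = 0)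
    (hv : Z' v ≠ 0) : η p = 0 := by
  have h1 := hZ.mul hη.hasFDerivAt
  have h2 := (hasFDerivAt_const (𝕜 := ℝ) (0 : ℝ) p).congr_of_eventuallyEq (f₁ := Z * η) h
  have h3 := DFunLike.congr_fun (h1.unique h2) v
  simp [hp] at h3
  exact h3.resolve_right hv

theorem theorem5
    (U : Set (Fin 3 → ℝ)) (hU : IsOpen U) (h0 : (0 : Fin 3 → ℝ) ∈ U)
    (L : (Fin 3 → ℝ) → (Fin 3 → ℝ) →L[ℝ] (Fin 3 → ℝ)) (hL : IsNijenhuisOn L U)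
    (hind : ∀ᶠ p in 𝓝 (0 : Fin 3 → ℝ),
      LinearIndependent ℝ ![fderiv ℝ (sigma L 1) p, fderiv ℝ (sigma L 2) p])
    (h1 : sigma L 1 0 = 0) (h2 : sigma L 2 0 = 0)
    (hMorse : HasMorseSingularityOnCurve (sigma L 3)
      {p | p ∈ U ∧ sigma L 1 p = 0 ∧ sigma L 2 p = 0} 0)
    (c : ℝ) (h3 : sigma L 3 0 = c) :
    ∃ (ε : ℝ) (φ : OpenPartialHomeomorph (Fin 3 → ℝ) (Fin 3 → ℝ)),
      (ε = 1 ∨ ε = -1) ∧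
      (0 : Fin 3 → ℝ) ∈ φ.source ∧ φ.source ⊆ U ∧ φ 0 = 0 ∧
      ContDiffOn ℝ ∞ φ φ.source ∧ ContDiffOn ℝ ∞ φ.symm φ.target ∧
      ∀ p ∈ φ.source,
        matrixInCoordinates L φ p = normalForm ε c (φ p 0) (φ p 1) (φ p 2) ∧
        ∀ t : ℝ, (L p : (Fin 3 → ℝ) →ₗ[ℝ] (Fin 3 → ℝ)).charpoly.eval t =
          t ^ 3 + φ p 0 * t ^ 2 + φ p 1 * t
            + ε * φ p 2 ^ 2 + cbrt c * φ p 1 - cbrt c ^ 2 * φ p 0 + c := by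
  obtain ⟨W₀, hW₀, hW₀o, h0W₀⟩ := eventually_nhds_iff.1 hind
  have hs1 := contDiffOn_sigma_one hL.smooth
  have hs2 := contDiffOn_sigma_two hL.smooth
  have hs3 := contDiffOn_sigma_three hL.smooth
  obtain ⟨ε, φ, G, r, hε, hr, hφ0, hφW, hφ00, hφ, hφs, hG, hGproj, hφp⟩ :=
    exists_morse_chart (hU.inter hW₀o) ⟨h0, h0W₀⟩ (hs1.mono inter_subset_left)
      (hs2.mono inter_subset_left) (hs3.mono inter_subset_left) (fun p hp => hW₀ p hp.2) h1 h2
      hMorse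
  have hφU : φ.source ⊆ U := fun p hp => (hφW hp).1
  have e1 : ∀ p ∈ φ.source, φ p 0 = sigma L 1 p := fun p hp => (hφp p hp).1
  have e2 : ∀ p ∈ φ.source, φ p 1 = sigma L 2 p := fun p hp => (hφp p hp).2.1
  have e3 : ∀ p ∈ φ.source, sigma L 3 p = G (φ p) + ε * φ p 2 ^ 2 := fun p hp => (hφp p hp).2.2
  have hGc : G 0 = c := by
    have := e3 0 hφ0
    simpa [hφ00, h3] using this.symm
  obtain ⟨ρ, hρ, hρr, haff⟩ := hL.exists_affine hU hφU hφ hφs (hφ00 ▸ φ.map_source hφ0) e1 e2 e3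
    hr hG hGproj
  rw [hGc] at haff
  have hε0 : ε ≠ 0 := by rcases hε with rfl | rfl <;> norm_num
  have hopen : IsOpen (φ.source ∩ φ ⁻¹' Metric.ball 0 ρ) :=
    φ.isOpen_inter_preimage Metric.isOpen_ball
  have hrow : ∀ p ∈ φ.source ∩ φ ⁻¹' Metric.ball 0 ρ, ∀ v,
      fderiv ℝ φ p (L p v) 0 = fderiv ℝ φ p v 1 - φ p 0 * fderiv ℝ φ p v 0 ∧
      fderiv ℝ φ p (L p v) 1 = -cbrt c ^ 2 * fderiv ℝ φ p v 0 + cbrt c * fderiv ℝ φ p v 1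
        + 2 * ε * φ p 2 * fderiv ℝ φ p v 2 - φ p 1 * fderiv ℝ φ p v 0 ∧
      φ p 2 * (2 * cbrt c * fderiv ℝ φ p v 2 + 2 * fderiv ℝ φ p (L p v) 2
        + φ p 2 * fderiv ℝ φ p v 0) = 0 := by
    intro p hp v
    obtain ⟨a, b, d⟩ := hL.chart_relation hU hφU hφ e1 e2 e3 hG hGproj hp.1
      (Metric.ball_subset_ball hρr hp.2) v
    obtain ⟨hA, hB, hGq⟩ := haff _ hp.2
    rw [hA, hB] at b
    refine ⟨a, b, ?_⟩
    rw [hA, hB, a, b, hGq] at d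
    -- After substituting the affine `G`, the terms free of `z` cancel because `cbrt c ^ 3 = c`;
    -- what remains is divisible by `ε z`.
    refine (mul_eq_zero.1 (?_ : ε * _ = 0)).resolve_left hε0
    linear_combination d + fderiv ℝ φ p v 0 * cbrt_pow_three c
  have hthird : ∀ p ∈ φ.source ∩ φ ⁻¹' Metric.ball 0 ρ, ∀ v,
      2 * cbrt c * fderiv ℝ φ p v 2 + 2 * fderiv ℝ φ p (L p v) 2 + φ p 2 * fderiv ℝ φ p v 0 = 0 := by
    intro p hp v
    by_cases hz : φ p 2 = 0
    · have hZ := hasFDerivAt_chart_apply hφ hp.1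
      have hJ : DifferentiableAt ℝ (fderiv ℝ φ) p :=
        ((hφ.fderiv_of_isOpen (m := ∞) φ.open_source (by simp)).contDiffAt
          (φ.open_source.mem_nhds hp.1)).differentiableAt (by simp)
      have hLd : DifferentiableAt ℝ L p :=
        (hL.smooth.contDiffAt (hU.mem_nhds (hφU hp.1))).differentiableAt (by simp)
      have hJv : ∀ i, DifferentiableAt ℝ (fun p => fderiv ℝ φ p v i) p := fun i =>
        differentiableAt_pi.1 (hJ.clm_apply (differentiableAt_const v)) i
      have hJLv : DifferentiableAt ℝ (fun p => fderiv ℝ φ p (L p v) 2) p :=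
        differentiableAt_pi.1 (hJ.clm_apply (hLd.clm_apply (differentiableAt_const v))) 2
      refine eq_zero_of_mul_eventuallyEq_zero (hZ 2)
        (η := fun p => 2 * cbrt c * fderiv ℝ φ p v 2 + 2 * fderiv ℝ φ p (L p v) 2
          + φ p 2 * fderiv ℝ φ p v 0)
        -- The direction is `∂/∂z`, along which `z` has derivative `1`.
        (v := fderiv ℝ φ.symm (φ p) (Pi.single 2 1)) ?_ ?_ hz ?_
      · exact (((hJv 2).const_mul _).add (hJLv.const_mul _)).add
          ((hZ 2).differentiableAt.mul (hJv 0))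
      · filter_upwards [hopen.mem_nhds hp] with q hq using (hrow q hq v).2.2
      · have := fderiv_chart_fderiv_symm hφ hφs (φ.map_source hp.1) (Pi.single 2 1)
        rw [φ.left_inv hp.1] at this
        simp [this]
    · exact (mul_eq_zero.1 (hrow p hp v).2.2).resolve_left hz
  refine ⟨ε, φ.restrOpen _ hopen, hε, ⟨hφ0, hφ0, ?_⟩, fun p hp => hφU hp.1, hφ00,
    hφ.mono fun p hp => hp.1, hφs.mono fun q hq => hq.1, fun p hp => ?_⟩
  · simpa [hφ00] using hρ
  obtain ⟨hps, hp⟩ : p ∈ φ.source ∧ p ∈ φ.source ∩ φ ⁻¹' Metric.ball 0 ρ := hp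
  change matrixInCoordinates L φ p = normalForm ε c (φ p 0) (φ p 1) (φ p 2) ∧ ∀ t : ℝ, _ =
    t ^ 3 + φ p 0 * t ^ 2 + φ p 1 * t
      + ε * φ p 2 ^ 2 + cbrt c * φ p 1 - cbrt c ^ 2 * φ p 0 + c
  constructor
  · have hinv : ∀ j, fderiv ℝ φ p (fderiv ℝ φ.symm (φ p) (Pi.single j 1)) = Pi.single j 1 := by
      intro j
      have := fderiv_chart_fderiv_symm hφ hφs (φ.map_source hps) (Pi.single j 1)
      rwa [φ.left_inv hps] at this
    have hentry : ∀ i j, matrixInCoordinates L φ p i j =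
        fderiv ℝ φ p (L p (fderiv ℝ φ.symm (φ p) (Pi.single j 1))) i := by
      intro i j
      simp [matrixInCoordinates, LinearMap.toMatrix'_apply]
    ext i j
    rw [hentry]
    obtain ⟨a, b, -⟩ := hrow p hp (fderiv ℝ φ.symm (φ p) (Pi.single j 1))
    have d := hthird p hp (fderiv ℝ φ.symm (φ p) (Pi.single j 1))
    rw [hinv] at a b d
    have d' : fderiv ℝ φ p (L p (fderiv ℝ φ.symm (φ p) (Pi.single j 1))) 2 =
        -cbrt c * (Pi.single j 1 : Fin 3 → ℝ) 2 - φ p 2 / 2 * (Pi.single j 1 : Fin 3 → ℝ) 0 := by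
      linear_combination d / 2
    fin_cases i
    · refine a.trans ?_
      fin_cases j <;> simp [normalForm]
    · refine b.trans ?_
      fin_cases j <;> simp [normalForm] <;> ring
    · refine d'.trans ?_
      fin_cases j <;> simp [normalForm]
  · intro t
    rw [charpoly_eval_eq_sigma, e3 p hps, (haff _ hp.2).2.2, e1 p hps, e2 p hps]
    ring
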